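/- Let $M$ be a smooth manifold and let $\mathcal TM$ be an extended tangent bundle on $M$, i.e. a Courant algebroid (Loday bracket $*$, non-degenerate symmetric pairing $\langle\cdot,\cdot\rangle$, anchor $a$) fitting into an exact sequence $0\to T^*M\xrightarrow{a^*}\mathcal TM\xrightarrow{a}TM\to0$, where $2\langle a^*\xi,\mathfrak X\rangle=\xi(a(\mathfrak X))$. Let $\mathcal J$ be an extended complex structure on $\mathcal TM$: an endomorphism with $\mathcal J^2=-1$, orthogonal for $\langle\cdot,\cdot\rangle$, whose $+i$-eigenbundle $L\subset\mathcal TM\otimes\mathbb C$ is involutive. Fix an isotropic splitting $s:TM\to\mathcal TM$, let $H(X,Y,Z)=2\langle s(X),s(Y)*s(Z)\rangle$, and identify spinors with complex differential forms of mixed degree. For a section $\mathfrak X=s(X)+\xi$ of $\mathcal TM$ put $$\iota_{\mathfrak X}=\iota_X+\xi\wedge,\qquad d_{\mathcal T}=d-H\wedge,\qquad \mathcal L^{\mathcal T}_{\mathfrak X}=\mathcal L_X+(d\xi-\iota_XH)\wedge .$$ Let $\rho\in\Omega^\bullet(M;\mathbb C)$ make $(M,\mathcal J;\rho)$ an extended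 Calabi–Yau manifold: $\rho$ is smooth and nowhere vanishing, is annihilated by $L$ under Clifford multiplication, and $d_{\mathcal T}\rho=0$. Let $G$ be a connected Lie group with Lie algebra $\mathfrak g$ acting on $\mathcal TM$ by extended symmetries, i.e. by automorphisms of the Courant algebroid $\mathcal TM$ covering a smooth action on $M$, generated by a linear map $\delta:\mathfrak g\to\Gamma(\mathcal TM)$ in the sense that $\frac{d}{dt}\big|_{t=0}\exp(t\tau)^*\mathfrak Y=\delta(\tau)*\mathfrak Y$ for all $\tau\in\mathfrak g$ and all sections $\mathfrak Y$. Suppose that the action is Hamiltonian with moment map $\mu:M\to\mathfrak g^*$: $\mu$ is smooth and $G$-equivariant, the action on $M$ is generated by the Hamiltonian vector fields $\pi^\sharp(d\mu_\tau)$ of the Poisson structure $\pi^\sharp=a\circ\mathcal J\circ a^*$, and $\delta(\tau)=\mathcal J(d\mu_\tau)$ for all $\tau\in\mathfrak g$, where $\mu_\tau=\langle\mu,\tau\rangle$ and $d\mu_\tau$ is regarded as a section of $\mathcal TM$ via $a^*$. Let $\{\tau_j\}$ be a basis of $\mathfrak g$ with dual basis $\{u_j\}$, write $\mu=\sum_j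 u_j\mu_j$, and consider the formal power series $\rho_G=e^{-i\mu}\rho$ in the variables $u_j$ with coefficients in $\Omega^\bullet(M;\mathbb C)$. Then: 1. $\delta$ is isotropic: $\langle\delta(\sigma),\delta(\tau)\rangle=0$ for all $\sigma,\tau\in\mathfrak g$; 2. $\rho_G$ is an equivariant extension of $\rho$: its constant term is $\rho$, and it belongs to the (complexified) extended $\mathfrak g$-equivariant Cartan complex, i.e. it has smooth coefficients and $\mathcal L^{\mathcal T}_{\delta(\tau)}\rho_G(\tau)=0$ for $\tau\in\mathfrak g$, in coordinates $\sum_j u_j\,\mathcal L^{\mathcal T}_{\delta(\tau_j)}\rho_G=0$; 3. $\rho_G$ is closed under the extended equivariant differential: $d_{\mathcal T}\rho_G-\sum_j u_j\,\iota_{\delta(\tau_j)}\rho_G=0$. -/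

import Mathlib

open scoped Manifold ContDiff TensorProduct
open Bundle

namespace ExtendedManifold

/-- The model vector space `ℝⁿ`. -/
abbrev Vec (n : ℕ) : Type := EuclideanSpace ℝ (Fin n)

/-! ### Mixed-degree complex forms on a vector space -/

section LinearAlgebra

variable {n : ℕ}

/-- Elements of `Λ^•(V^*) ⊗ ℂ` for `V = ℝⁿ`, given by their components in each degree `k`
(which vanish for `k > n`). -/
abbrev MixedForm (n : ℕ) : Type := (k : ℕ) → Vec n [⋀^Fin k]→L[ℝ] ℂ

/-- Contraction `ι_v θ`. -/
noncomputable def contract (v : Vec n) (θ : MixedForm n) : MixedForm n :=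
  fun k => (θ (k + 1)).curryLeft v

/-- Exterior product `ξ ∧ θ` with a covector `ξ`:
`(ξ ∧ θ)(v₀, …, v_k) = ∑ i, (-1)^i ξ(v_i) θ(v₀, …, v̂_i, …, v_k)`. -/
noncomputable def covectorWedge (ξ : Vec n →L[ℝ] ℝ) (θ : MixedForm n) : MixedForm n
  | 0 => 0
  | k + 1 => ContinuousAlternatingMap.alternatizeUncurryFin (ξ.smulRight (θ k))

/-- Exterior product `α ∧ θ` with a `p`-form `α`, computed from
`α = (1/p!) ∑ α(e_{i₁}, …, e_{i_p}) e^{i₁} ∧ ⋯ ∧ e^{i_p}` in the standard basis. -/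
noncomputable def wedge {p : ℕ} (α : Vec n [⋀^Fin p]→L[ℝ] ℝ) (θ : MixedForm n) : MixedForm n :=
  ((p.factorial : ℝ)⁻¹) • ∑ f : Fin p → Fin n,
    α (fun i => EuclideanSpace.single (f i) (1 : ℝ)) •
      (List.ofFn f).foldr (fun j η => covectorWedge (EuclideanSpace.proj j) η) θ

/-- The Clifford action of `v + ξ ∈ V ⊕ V^*` on forms, `ρ ↦ ι_v ρ + ξ ∧ ρ`. -/
noncomputable def clifford (v : Vec n) (ξ : Vec n →L[ℝ] ℝ) (θ : MixedForm n) : MixedForm n :=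
  contract v θ + covectorWedge ξ θ

theorem covectorWedge_add_left (ξ η : Vec n →L[ℝ] ℝ) (θ : MixedForm n) :
    covectorWedge (ξ + η) θ = covectorWedge ξ θ + covectorWedge η θ := by
  funext k
  cases k with
  | zero => simp [covectorWedge]
  | succ k =>
    ext v
    simp [covectorWedge, ContinuousAlternatingMap.alternatizeUncurryFin_apply, add_mul,
      Finset.sum_add_distrib]

theorem covectorWedge_smul_left (c : ℝ) (ξ : Vec n →L[ℝ] ℝ) (θ : MixedForm n) :
    covectorWedge (c • ξ) θ = c • covectorWedge ξ θ := by
  funext k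
  cases k with
  | zero => ext v; simp [covectorWedge]
  | succ k =>
    ext v
    simp [covectorWedge, ContinuousAlternatingMap.alternatizeUncurryFin_apply,
      Finset.mul_sum, mul_left_comm, mul_assoc]

theorem covectorWedge_add_right (ξ : Vec n →L[ℝ] ℝ) (θ η : MixedForm n) :
    covectorWedge ξ (θ + η) = covectorWedge ξ θ + covectorWedge ξ η := by
  funext k
  cases k with
  | zero => simp [covectorWedge]
  | succ k =>
    ext v
    simp [covectorWedge, ContinuousAlternatingMap.alternatizeUncurryFin_apply,
      Finset.sum_add_distrib]

theorem covectorWedge_smul_right (c : ℂ) (ξ : Vec n →L[ℝ] ℝ) (θ : MixedForm n) :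
    covectorWedge ξ (c • θ) = c • covectorWedge ξ θ := by
  funext k
  cases k with
  | zero => ext v; simp [covectorWedge]
  | succ k =>
    ext v
    simp [covectorWedge, ContinuousAlternatingMap.alternatizeUncurryFin_apply, Finset.mul_sum,
      mul_left_comm]

theorem contract_add_left (v w : Vec n) (θ : MixedForm n) :
    contract (v + w) θ = contract v θ + contract w θ := by
  funext k; simp [contract]

theorem contract_smul_left (c : ℝ) (v : Vec n) (θ : MixedForm n) :
    contract (c • v) θ = c • contract v θ := by
  funext k; simp [contract]

theorem contract_add_right (v : Vec n) (θ η : MixedForm n) :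
    contract v (θ + η) = contract v θ + contract v η := by
  funext k; simp [contract]

theorem contract_smul_right (c : ℂ) (v : Vec n) (θ : MixedForm n) :
    contract v (c • θ) = c • contract v θ := by
  funext k; ext w; simp [contract]

theorem clifford_add_right (v : Vec n) (ξ : Vec n →L[ℝ] ℝ) (θ η : MixedForm n) :
    clifford v ξ (θ + η) = clifford v ξ θ + clifford v ξ η := by
  simp only [clifford, contract_add_right, covectorWedge_add_right]; abel

theorem clifford_smul_right (c : ℂ) (v : Vec n) (ξ : Vec n →L[ℝ] ℝ) (θ : MixedForm n) :
    clifford v ξ (c • θ) = c • clifford v ξ θ := by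
  simp only [clifford, contract_smul_right, covectorWedge_smul_right, smul_add]

theorem clifford_add_left (v w : Vec n) (ξ η : Vec n →L[ℝ] ℝ) (θ : MixedForm n) :
    clifford (v + w) (ξ + η) θ = clifford v ξ θ + clifford w η θ := by
  simp only [clifford, contract_add_left, covectorWedge_add_left]; abel

theorem clifford_smul_left (c : ℝ) (v : Vec n) (ξ : Vec n →L[ℝ] ℝ) (θ : MixedForm n) :
    clifford (c • v) (c • ξ) θ = c • clifford v ξ θ := by
  simp only [clifford, contract_smul_left, covectorWedge_smul_left, smul_add]

end LinearAlgebra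

/-! ### Differential forms on a manifold -/

section Forms

variable {n : ℕ} {M : Type*} [TopologicalSpace M] [ChartedSpace (Vec n) M]

variable (n M) in
/-- Smooth vector fields on `M`. -/
abbrev VField [IsManifold (𝓡 n) ∞ M] : Type _ :=
  Cₛ^∞⟮𝓡 n; Vec n, (TangentSpace (𝓡 n) : M → Type)⟯

variable (n M) in
/-- (Not necessarily smooth) differential `k`-forms on `M` with values in `W`. -/
abbrev DForm (W : Type*) [NormedAddCommGroup W] [NormedSpace ℝ W] (k : ℕ) : Type _ :=
  (x : M) → TangentSpace (𝓡 n) x [⋀^Fin k]→L[ℝ] W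

variable (n M) in
/-- (Not necessarily smooth) complex differential forms of mixed degree on `M`, i.e. sections of
`Λ^•T^*M ⊗ ℂ`. -/
abbrev MixedDForm : Type _ := (x : M) → (k : ℕ) → TangentSpace (𝓡 n) x [⋀^Fin k]→L[ℝ] ℂ

section

variable {W : Type*} [NormedAddCommGroup W] [NormedSpace ℝ W] {k : ℕ}

/-- The form `θ` in the preferred chart `φ` around `x₀`: the pullback of `θ` under `φ⁻¹`. -/
noncomputable def localRep (θ : DForm n M W k) (x₀ : M) (y : Vec n) : Vec n [⋀^Fin k]→L[ℝ] W :=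
  (θ ((extChartAt (𝓡 n) x₀).symm y)).compContinuousLinearMap
    (mfderiv 𝓘(ℝ, Vec n) (𝓡 n) (extChartAt (𝓡 n) x₀).symm y)

/-- A vector field in the preferred chart around `x₀`. -/
noncomputable def localField (X : (x : M) → TangentSpace (𝓡 n) x) (x₀ : M) (y : Vec n) : Vec n :=
  mfderiv (𝓡 n) 𝓘(ℝ, Vec n) (extChartAt (𝓡 n) x₀) ((extChartAt (𝓡 n) x₀).symm y)
    (X ((extChartAt (𝓡 n) x₀).symm y))

/-- Smoothness of a form: its coefficients are smooth in each preferred chart. -/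
def IsSmoothForm (θ : DForm n M W k) : Prop :=
  ∀ x₀ : M, ContDiffOn ℝ ∞ (localRep θ x₀) (extChartAt (𝓡 n) x₀).target

/-- The exterior derivative `dθ`, computed in the preferred chart around each point. -/
noncomputable def extD (θ : DForm n M W k) : DForm n M W (k + 1) := fun x =>
  (extDeriv (localRep θ x) (extChartAt (𝓡 n) x x)).compContinuousLinearMap
    (mfderiv (𝓡 n) 𝓘(ℝ, Vec n) (extChartAt (𝓡 n) x) x)

/-- The Lie derivative in coordinates,
`(L_X θ)(v₁, …, v_k) = (∂_X θ)(v₁, …, v_k) + ∑ i, θ(v₁, …, ∂_{v_i} X, …, v_k)`. -/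
noncomputable def localLieD (X : Vec n → Vec n) (θ : Vec n → Vec n [⋀^Fin k]→L[ℝ] W) (y : Vec n) :
    Vec n [⋀^Fin k]→L[ℝ] W :=
  fderiv ℝ θ y (X y) +
    (θ y).fderivCompContinuousLinearMap (ContinuousLinearMap.id ℝ (Vec n)) (fderiv ℝ X y)

theorem localLieD_apply (X : Vec n → Vec n) (θ : Vec n → Vec n [⋀^Fin k]→L[ℝ] W) (y : Vec n)
    (v : Fin k → Vec n) :
    localLieD X θ y v =
      fderiv ℝ θ y (X y) v + ∑ i, θ y (Function.update v i (fderiv ℝ X y (v i))) := by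
  simp only [localLieD, ContinuousAlternatingMap.add_apply,
    ContinuousAlternatingMap.fderivCompContinuousLinearMap_apply]
  congr 1
  refine Finset.sum_congr rfl fun i _ => ?_
  congr 1
  funext j
  by_cases h : j = i
  · subst h; simp
  · simp [h]

/-- The Lie derivative `L_X θ`, computed in the preferred chart around each point. -/
noncomputable def lieD (X : (x : M) → TangentSpace (𝓡 n) x) (θ : DForm n M W k) : DForm n M W k :=
  fun x => (localLieD (localField X x) (localRep θ x) (extChartAt (𝓡 n) x x)).compContinuousLinearMap
    (mfderiv (𝓡 n) 𝓘(ℝ, Vec n) (extChartAt (𝓡 n) x) x)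

end

/-- Smoothness of a form of mixed degree. -/
def IsSmoothMixed (θ : MixedDForm n M) : Prop :=
  ∀ k : ℕ, IsSmoothForm (fun x => θ x k)

/-- The exterior derivative of a form of mixed degree. -/
noncomputable def extDMixed (θ : MixedDForm n M) : MixedDForm n M
  | _, 0 => 0
  | x, k + 1 => extD (fun x => θ x k) x

/-- The Lie derivative of a form of mixed degree. -/
noncomputable def lieDMixed (X : (x : M) → TangentSpace (𝓡 n) x) (θ : MixedDForm n M) :
    MixedDForm n M :=
  fun x k => lieD X (fun x => θ x k) x

/-- The exterior product `α ∧ θ` of a real `p`-form and a form of mixed degree. -/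
noncomputable def wedgeMixed {p : ℕ} (α : DForm n M ℝ p) (θ : MixedDForm n M) : MixedDForm n M :=
  fun x => wedge (α x) (θ x)

end Forms

/-! ### Extended tangent bundles (exact Courant algebroids) -/

section Courant

variable (n : ℕ) (M : Type*) [TopologicalSpace M] [ChartedSpace (Vec n) M] [IsManifold (𝓡 n) ∞ M]
  (F : Type*) [NormedAddCommGroup F] [NormedSpace ℝ F]
  (E : M → Type*) [TopologicalSpace (TotalSpace F E)] [∀ x, TopologicalSpace (E x)]
  [∀ x, AddCommGroup (E x)] [∀ x, Module ℝ (E x)] [∀ x, IsTopologicalAddGroup (E x)]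
  [∀ x, ContinuousSMul ℝ (E x)] [FiberBundle F E] [VectorBundle ℝ F E]

/-- An extended tangent bundle structure on a smooth vector bundle `E → M`: a Courant algebroid
which is an extension `0 → T^*M → E → TM → 0`. The map `T^*M → E` is the transpose of the anchor
with respect to twice the pairing. -/
structure ExtendedTangentBundle where
  /-- the anchor `a : E → TM` -/
  anchor : (x : M) → E x →L[ℝ] TangentSpace (𝓡 n) x
  /-- the pairing `⟨ , ⟩` -/
  pairing : (x : M) → E x →L[ℝ] E x →L[ℝ] ℝ
  /-- the inclusion `a^* : T^*M → E` -/
  coanchor : (x : M) → (TangentSpace (𝓡 n) x →L[ℝ] ℝ) →L[ℝ] E x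
  /-- the Loday bracket `*` on sections -/
  bracket : Cₛ^∞⟮𝓡 n; F, E⟯ →ₗ[ℝ] Cₛ^∞⟮𝓡 n; F, E⟯ →ₗ[ℝ] Cₛ^∞⟮𝓡 n; F, E⟯
  anchor_smooth : ContMDiff (𝓡 n) ((𝓡 n).prod 𝓘(ℝ, F →L[ℝ] Vec n)) ∞
    (fun x => TotalSpace.mk' (F →L[ℝ] Vec n)
      (E := fun x => E x →L[ℝ] TangentSpace (𝓡 n) x) x (anchor x))
  pairing_smooth : ContMDiff (𝓡 n) ((𝓡 n).prod 𝓘(ℝ, F →L[ℝ] F →L[ℝ] ℝ)) ∞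
    (fun x => TotalSpace.mk' (F →L[ℝ] F →L[ℝ] ℝ)
      (E := fun x => E x →L[ℝ] E x →L[ℝ] ℝ) x (pairing x))
  coanchor_smooth : ContMDiff (𝓡 n) ((𝓡 n).prod 𝓘(ℝ, (Vec n →L[ℝ] ℝ) →L[ℝ] F)) ∞
    (fun x => TotalSpace.mk' ((Vec n →L[ℝ] ℝ) →L[ℝ] F)
      (E := fun x => (TangentSpace (𝓡 n) x →L[ℝ] ℝ) →L[ℝ] E x) x (coanchor x))
  pairing_symm : ∀ x v w, pairing x v w = pairing x w v
  pairing_nondegenerate : ∀ x v, (∀ w, pairing x v w = 0) → v = 0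
  /-- the Jacobi identity -/
  jacobi : ∀ X Y Z, bracket X (bracket Y Z) = bracket (bracket X Y) Z + bracket Y (bracket X Z)
  anchor_pairing_symm : ∀ (X Y Z : Cₛ^∞⟮𝓡 n; F, E⟯) (x : M),
    mfderiv (𝓡 n) 𝓘(ℝ, ℝ) (fun y => pairing y (Y y) (Z y)) x (anchor x (X x)) =
      pairing x (X x) ((bracket Y Z + bracket Z Y) x)
  anchor_pairing_invariant : ∀ (X Y Z : Cₛ^∞⟮𝓡 n; F, E⟯) (x : M),
    mfderiv (𝓡 n) 𝓘(ℝ, ℝ) (fun y => pairing y (Y y) (Z y)) x (anchor x (X x)) =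
      pairing x (bracket X Y x) (Z x) + pairing x (Y x) (bracket X Z x)
  pairing_coanchor : ∀ x (ξ : TangentSpace (𝓡 n) x →L[ℝ] ℝ) (v : E x),
    2 * pairing x (coanchor x ξ) v = ξ (anchor x v)
  coanchor_injective : ∀ x, Function.Injective (coanchor x)
  exact : ∀ x, Function.Exact (coanchor x) (anchor x)
  anchor_surjective : ∀ x, Function.Surjective (anchor x)

end Courant

section Splitting

variable {n : ℕ} {M : Type*} [TopologicalSpace M] [ChartedSpace (Vec n) M] [IsManifold (𝓡 n) ∞ M]
  {F : Type*} [NormedAddCommGroup F] [NormedSpace ℝ F]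
  {E : M → Type*} [TopologicalSpace (TotalSpace F E)] [∀ x, TopologicalSpace (E x)]
  [∀ x, AddCommGroup (E x)] [∀ x, Module ℝ (E x)] [∀ x, IsTopologicalAddGroup (E x)]
  [∀ x, ContinuousSMul ℝ (E x)] [FiberBundle F E] [VectorBundle ℝ F E]

/-- An isotropic splitting `s : TM → E` of the anchor. -/
structure IsotropicSplitting (C : ExtendedTangentBundle n M F E) where
  /-- the splitting on each tangent space -/
  toFun : (x : M) → TangentSpace (𝓡 n) x →L[ℝ] E x
  smooth : ContMDiff (𝓡 n) ((𝓡 n).prod 𝓘(ℝ, Vec n →L[ℝ] F)) ∞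
    (fun x => TotalSpace.mk' (Vec n →L[ℝ] F)
      (E := fun x => TangentSpace (𝓡 n) x →L[ℝ] E x) x (toFun x))
  anchor_toFun : ∀ x v, C.anchor x (toFun x v) = v
  isotropic : ∀ x v w, C.pairing x (toFun x v) (toFun x w) = 0

variable {C : ExtendedTangentBundle n M F E}

/-! ### Spinors and the Cartan operators

An isotropic splitting `s` identifies spinors with forms of mixed degree. -/

/-- The covector `ξ` with `𝔛 = s(a(𝔛)) + ξ`; see `coanchor_covectorPart`. -/
noncomputable def IsotropicSplitting.covectorPart (s : IsotropicSplitting C) (x : M) (e : E x) :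
    TangentSpace (𝓡 n) x →L[ℝ] ℝ :=
  (2 : ℝ) • (C.pairing x (e - s.toFun x (C.anchor x e))).comp (s.toFun x)

theorem IsotropicSplitting.coanchor_covectorPart (s : IsotropicSplitting C) (x : M) (e : E x) :
    C.coanchor x (s.covectorPart x e) = e - s.toFun x (C.anchor x e) := by
  obtain ⟨η, hη⟩ := (C.exact x (e - s.toFun x (C.anchor x e))).1
    (by rw [map_sub, s.anchor_toFun, sub_self])
  rw [← hη]
  congr 1
  ext v
  have := C.pairing_coanchor x η (s.toFun x v)
  rw [s.anchor_toFun] at this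
  simpa [IsotropicSplitting.covectorPart, hη] using this

/-- Clifford multiplication `ι_𝔛 = ι_X + ξ ∧` by elements of `E_x`. -/
noncomputable def IsotropicSplitting.cliffordHom (s : IsotropicSplitting C) (x : M) :
    E x →ₗ[ℝ] Module.End ℂ (MixedForm n) where
  toFun e :=
    { toFun := fun θ => clifford (C.anchor x e) (s.covectorPart x e) θ
      map_add' := clifford_add_right _ _
      map_smul' := fun c => clifford_smul_right c _ _ }
  map_add' e e' := by
    ext1 θ
    have h : s.covectorPart x (e + e') = s.covectorPart x e + s.covectorPart x e' := by
      ext v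
      simp only [IsotropicSplitting.covectorPart, map_add, add_apply, smul_apply, map_sub,
        ContinuousLinearMap.comp_apply, sub_apply, smul_eq_mul]
      ring
    change clifford _ _ _ = clifford _ _ _ + clifford _ _ _
    rw [h, map_add]
    exact clifford_add_left _ _ _ _ _
  map_smul' c e := by
    ext1 θ
    have h : s.covectorPart x (c • e) = c • s.covectorPart x e := by
      ext v
      simp only [IsotropicSplitting.covectorPart, map_smul, smul_apply, map_sub,
        ContinuousLinearMap.comp_apply, sub_apply, smul_eq_mul]
      ring
    change clifford _ _ _ = c • clifford _ _ _
    rw [h, map_smul]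
    exact clifford_smul_left _ _ _ _

/-- Clifford multiplication by elements of `E_x ⊗ ℂ`. -/
noncomputable def IsotropicSplitting.cliffordComplex (s : IsotropicSplitting C) (x : M) :
    ℂ ⊗[ℝ] E x →ₗ[ℂ] Module.End ℂ (MixedForm n) :=
  (s.cliffordHom x).liftBaseChange ℂ

/-- The operator `ι_𝔛` on spinors, for a section `𝔛` of `E`. -/
noncomputable def IsotropicSplitting.iota (s : IsotropicSplitting C) (X : Cₛ^∞⟮𝓡 n; F, E⟯)
    (ρ : MixedDForm n M) : MixedDForm n M :=
  fun x => s.cliffordHom x (X x) (ρ x)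

/-- The 1-form `ξ` with `𝔛 = s(X) + ξ`. -/
noncomputable def IsotropicSplitting.oneForm (s : IsotropicSplitting C)
    (X : Cₛ^∞⟮𝓡 n; F, E⟯) : DForm n M ℝ 1 :=
  fun x => ContinuousAlternatingMap.ofSubsingleton ℝ (TangentSpace (𝓡 n) x) ℝ (0 : Fin 1)
    (s.covectorPart x (X x))

/-! ### The twisting form -/

/-- The section `s(X)` of `E` for a vector field `X`. -/
noncomputable def IsotropicSplitting.lift (s : IsotropicSplitting C) (X : VField n M) : Cₛ^∞⟮𝓡 n; F, E⟯ :=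
  ⟨fun x => s.toFun x (X x), s.smooth.clm_bundle_apply X.contMDiff⟩

/-- The function `2⟨s(X), s(Y) * s(Z)⟩`. -/
noncomputable def IsotropicSplitting.twist (s : IsotropicSplitting C) (X Y Z : VField n M) (x : M) :
    ℝ :=
  2 * C.pairing x (s.lift X x) (C.bracket (s.lift Y) (s.lift Z) x)

theorem IsotropicSplitting.pairing_lift (s : IsotropicSplitting C) (X Y : VField n M) :
    (fun y => C.pairing y (s.lift X y) (s.lift Y y)) = fun _ => 0 :=
  funext fun y => s.isotropic y (X y) (Y y)

theorem IsotropicSplitting.twist_swap_right (s : IsotropicSplitting C) (X Y Z : VField n M)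
    (x : M) : s.twist X Y Z x = - s.twist X Z Y x := by
  have h := C.anchor_pairing_symm (s.lift X) (s.lift Y) (s.lift Z) x
  rw [s.pairing_lift, mfderiv_const] at h
  have h' : C.pairing x (s.lift X x) (C.bracket (s.lift Y) (s.lift Z) x) +
      C.pairing x (s.lift X x) (C.bracket (s.lift Z) (s.lift Y) x) = 0 := by
    rw [← map_add]; exact h.symm
  simp only [IsotropicSplitting.twist]
  linarith

theorem IsotropicSplitting.twist_swap_outer (s : IsotropicSplitting C) (X Y Z : VField n M)
    (x : M) : s.twist X Y Z x = - s.twist Z Y X x := by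
  have h := C.anchor_pairing_invariant (s.lift Y) (s.lift X) (s.lift Z) x
  rw [s.pairing_lift, mfderiv_const] at h
  have h' : C.pairing x (C.bracket (s.lift Y) (s.lift X) x) (s.lift Z x) +
      C.pairing x (s.lift X x) (C.bracket (s.lift Y) (s.lift Z) x) = 0 := h.symm
  rw [C.pairing_symm] at h'
  simp only [IsotropicSplitting.twist]
  linarith

theorem IsotropicSplitting.twist_rotate (s : IsotropicSplitting C) (X Y Z : VField n M)
    (x : M) : s.twist X Y Z x = s.twist Y Z X x := by
  rw [s.twist_swap_right X Y Z, s.twist_swap_outer X Z Y, neg_neg]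

theorem IsotropicSplitting.twist_congr (s : IsotropicSplitting C) {X X' Y Y' Z Z' : VField n M}
    {x : M} (hX : X x = X' x) (hY : Y x = Y' x) (hZ : Z x = Z' x) :
    s.twist X Y Z x = s.twist X' Y' Z' x := by
  have key : ∀ {A A' : VField n M} (B D : VField n M), A x = A' x →
      s.twist A B D x = s.twist A' B D x := by
    intro A A' B D h
    simp only [IsotropicSplitting.twist]
    have : s.lift A x = s.lift A' x := congrArg (s.toFun x) h
    rw [this]
  rw [key Y Z hX, s.twist_rotate, key Z X' hY, s.twist_rotate, key X' Y' hZ, s.twist_rotate]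

variable [T2Space M] [SigmaCompactSpace M]

theorem exists_vField (x : M) (v : TangentSpace (𝓡 n) x) : ∃ X : VField n M, X x = v := by
  classical
  obtain ⟨X, hX⟩ := exists_contMDiffSection_forall_mem_convex_of_local (𝓡 n) (n := ⊤)
    (F_fiber := Vec n) (TangentSpace (𝓡 n) : M → Type)
    (fun y => {w | ∀ h : y = x, w = h ▸ v})
    (fun y w₁ h₁ w₂ h₂ a b _ _ hab h => by
      rw [h₁ h, h₂ h, ← add_smul, hab, one_smul])
    (fun x₀ => by
      by_cases h : x₀ = x
      · subst h
        obtain ⟨U, hU, hs⟩ := FiberBundle.exists_contMDiffOn_extend (k := ∞) (𝓡 n) (Vec n) v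
        refine ⟨U, hU, _, hs, fun y _ h => ?_⟩
        subst h
        simp
      · refine ⟨{x}ᶜ, isOpen_compl_singleton.mem_nhds h, fun _ => 0, ?_, fun y hy h => ?_⟩
        · exact (contMDiff_zeroSection ℝ _).contMDiffOn
        · exact absurd h hy)
  exact ⟨X, hX x rfl⟩

/-- A vector field with prescribed value at `x`. -/
noncomputable def vFieldAt (x : M) (v : TangentSpace (𝓡 n) x) : VField n M :=
  (exists_vField x v).choose

theorem vFieldAt_apply (x : M) (v : TangentSpace (𝓡 n) x) : vFieldAt x v x = v :=
  (exists_vField x v).choose_spec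

theorem IsotropicSplitting.twist_vFieldAt_add (s : IsotropicSplitting C) (x : M)
    (u u' : TangentSpace (𝓡 n) x) (Y Z : VField n M) :
    s.twist (vFieldAt x (u + u')) Y Z x =
      s.twist (vFieldAt x u) Y Z x + s.twist (vFieldAt x u') Y Z x := by
  have h : ∀ w : TangentSpace (𝓡 n) x, s.lift (vFieldAt x w) x = s.toFun x w :=
    fun w => congrArg (s.toFun x) (vFieldAt_apply x w)
  simp only [IsotropicSplitting.twist, h, map_add, add_apply, mul_add]

theorem IsotropicSplitting.twist_vFieldAt_smul (s : IsotropicSplitting C) (x : M) (c : ℝ)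
    (u : TangentSpace (𝓡 n) x) (Y Z : VField n M) :
    s.twist (vFieldAt x (c • u)) Y Z x = c * s.twist (vFieldAt x u) Y Z x := by
  have h : ∀ w : TangentSpace (𝓡 n) x, s.lift (vFieldAt x w) x = s.toFun x w :=
    fun w => congrArg (s.toFun x) (vFieldAt_apply x w)
  simp only [IsotropicSplitting.twist, h, map_smul, smul_apply, smul_eq_mul]
  ring

/-- The alternating trilinear map `H_x`. -/
noncomputable def IsotropicSplitting.twistingAux (s : IsotropicSplitting C) (x : M) :
    TangentSpace (𝓡 n) x [⋀^Fin 3]→ₗ[ℝ] ℝ where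
  toFun v := s.twist (vFieldAt x (v 0)) (vFieldAt x (v 1)) (vFieldAt x (v 2)) x
  map_update_add' := by
    intro inst v i a b
    have : inst = instDecidableEqFin 3 := Subsingleton.elim _ _
    subst this
    fin_cases i
    · simpa using s.twist_vFieldAt_add x a b _ _
    · have := s.twist_vFieldAt_add x a b (vFieldAt x (v 2)) (vFieldAt x (v 0))
      simpa [s.twist_rotate (vFieldAt x (v 0))] using this
    · have := s.twist_vFieldAt_add x a b (vFieldAt x (v 0)) (vFieldAt x (v 1))
      simpa [s.twist_rotate _ (vFieldAt x (v 0)) (vFieldAt x (v 1))] using this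
  map_update_smul' := by
    intro inst v i c a
    have : inst = instDecidableEqFin 3 := Subsingleton.elim _ _
    subst this
    fin_cases i
    · simpa using s.twist_vFieldAt_smul x c a _ _
    · have := s.twist_vFieldAt_smul x c a (vFieldAt x (v 2)) (vFieldAt x (v 0))
      simpa [s.twist_rotate (vFieldAt x (v 0))] using this
    · have := s.twist_vFieldAt_smul x c a (vFieldAt x (v 0)) (vFieldAt x (v 1))
      simpa [s.twist_rotate _ (vFieldAt x (v 0)) (vFieldAt x (v 1))] using this
  map_eq_zero_of_eq' := by
    intro v i j hij hne
    have h₁ : ∀ X Y : VField n M, s.twist X Y Y x = 0 := fun X Y => by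
      linarith [s.twist_swap_right X Y Y x]
    have h₂ : ∀ X Y : VField n M, s.twist X Y X x = 0 := fun X Y => by
      linarith [s.twist_swap_outer X Y X x]
    have h₃ : ∀ X Y : VField n M, s.twist X X Y x = 0 := fun X Y => by
      rw [s.twist_rotate, h₂]
    fin_cases i <;> fin_cases j <;> simp_all

theorem continuous_alternatingMap {V : Type*} [AddCommGroup V] [Module ℝ V] [TopologicalSpace V]
    [IsTopologicalAddGroup V] [ContinuousSMul ℝ V] [T2Space V] [FiniteDimensional ℝ V] {k : ℕ}
    (f : V [⋀^Fin k]→ₗ[ℝ] ℝ) : Continuous f := by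
  classical
  let b := Module.finBasis ℝ V
  have h : (f : (Fin k → V) → ℝ) = fun v => ∑ r : Fin k → Fin (Module.finrank ℝ V),
      (∏ i, b.repr (v i) (r i)) • f (fun i => b (r i)) := by
    funext v
    have hv : v = fun i => ∑ j, b.repr (v i) j • b j := funext fun i => (b.sum_repr (v i)).symm
    conv_lhs => rw [hv]
    change f.toMultilinearMap _ = _
    rw [MultilinearMap.map_sum]
    refine Finset.sum_congr rfl fun r _ => ?_
    rw [MultilinearMap.map_smul_univ]
    rfl
  rw [h]
  refine continuous_finsetSum _ fun r _ => ?_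
  simp only [smul_eq_mul]
  refine Continuous.mul (continuous_finsetProd _ fun i _ => ?_) continuous_const
  exact (LinearMap.continuous_of_finiteDimensional (b.coord (r i))).comp (continuous_apply i)

/-- The 3-form `H(X, Y, Z) = 2⟨s(X), s(Y) * s(Z)⟩` determined by an isotropic splitting. -/
noncomputable def IsotropicSplitting.twisting (s : IsotropicSplitting C) : DForm n M ℝ 3 :=
  fun x =>
    { s.twistingAux x with
      cont :=
        haveI : T2Space (TangentSpace (𝓡 n) x) := inferInstanceAs (T2Space (Vec n))
        haveI : FiniteDimensional ℝ (TangentSpace (𝓡 n) x) :=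
          inferInstanceAs (FiniteDimensional ℝ (Vec n))
        continuous_alternatingMap (s.twistingAux x) }

theorem IsotropicSplitting.twisting_apply (s : IsotropicSplitting C) (X Y Z : VField n M) (x : M) :
    s.twisting x ![X x, Y x, Z x] =
      2 * C.pairing x (s.lift X x) (C.bracket (s.lift Y) (s.lift Z) x) :=
  s.twist_congr (vFieldAt_apply _ _) (vFieldAt_apply _ _) (vFieldAt_apply _ _)

/-! ### The differential and the Lie derivative on spinors -/

/-- The differential `d_𝒯 = d - H ∧` on spinors. -/
noncomputable def IsotropicSplitting.dT (s : IsotropicSplitting C) (ρ : MixedDForm n M) :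
    MixedDForm n M :=
  extDMixed ρ - wedgeMixed s.twisting ρ

/-- The 2-form `ι_X H`. -/
noncomputable def IsotropicSplitting.twistingContract (s : IsotropicSplitting C)
    (X : Cₛ^∞⟮𝓡 n; F, E⟯) : DForm n M ℝ 2 :=
  fun x => ContinuousAlternatingMap.curryLeft (E := Vec n) (s.twisting x) (C.anchor x (X x))

/-- The Lie derivative `L_𝔛 = L_X + (dξ - ι_X H) ∧` on spinors. -/
noncomputable def IsotropicSplitting.lieT (s : IsotropicSplitting C) (X : Cₛ^∞⟮𝓡 n; F, E⟯)
    (ρ : MixedDForm n M) : MixedDForm n M :=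
  lieDMixed (fun x => C.anchor x (X x)) ρ +
    wedgeMixed (extD (s.oneForm X) - s.twistingContract X) ρ

end Splitting

/-! ### Extended complex structures and extended Calabi–Yau manifolds -/

section Complex

variable {n : ℕ} {M : Type*} [TopologicalSpace M] [ChartedSpace (Vec n) M] [IsManifold (𝓡 n) ∞ M]
  {F : Type*} [NormedAddCommGroup F] [NormedSpace ℝ F]
  {E : M → Type*} [TopologicalSpace (TotalSpace F E)] [∀ x, TopologicalSpace (E x)]
  [∀ x, AddCommGroup (E x)] [∀ x, Module ℝ (E x)] [∀ x, IsTopologicalAddGroup (E x)]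
  [∀ x, ContinuousSMul ℝ (E x)] [FiberBundle F E] [VectorBundle ℝ F E]

/-- The `+i`-eigenspace of (the complexification of) an endomorphism of `E_x`. -/
noncomputable def iEigenspace {x : M} (J : E x →L[ℝ] E x) : Submodule ℂ (ℂ ⊗[ℝ] E x) :=
  Module.End.eigenspace ((J : E x →ₗ[ℝ] E x).baseChange ℂ) Complex.I

/-- `Y + iZ` is a section of the `+i`-eigenbundle `L` of `J`. -/
def IsEigensection (J : (x : M) → E x →L[ℝ] E x) (Y Z : Cₛ^∞⟮𝓡 n; F, E⟯) : Prop :=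
  ∀ x, (1 : ℂ) ⊗ₜ[ℝ] Y x + Complex.I ⊗ₜ[ℝ] Z x ∈ iEigenspace (J x)

/-- An extended complex structure on `E`: an orthogonal complex structure whose `+i`-eigenbundle
is closed under the complex bilinear extension
`(Y + iZ) * (Y' + iZ') = (Y * Y' - Z * Z') + i(Y * Z' + Z * Y')` of the Loday bracket. -/
structure ExtendedComplexStructure (C : ExtendedTangentBundle n M F E) where
  /-- the endomorphism of each fibre -/
  J : (x : M) → E x →L[ℝ] E x
  smooth : ContMDiff (𝓡 n) ((𝓡 n).prod 𝓘(ℝ, F →L[ℝ] F)) ∞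
    (fun x => TotalSpace.mk' (F →L[ℝ] F) (E := fun x => E x →L[ℝ] E x) x (J x))
  sq : ∀ x v, J x (J x v) = -v
  orthogonal : ∀ x v w, C.pairing x (J x v) (J x w) = C.pairing x v w
  involutive : ∀ Y Z Y' Z' : Cₛ^∞⟮𝓡 n; F, E⟯, IsEigensection J Y Z → IsEigensection J Y' Z' →
    IsEigensection J (C.bracket Y Y' - C.bracket Z Z') (C.bracket Y Z' + C.bracket Z Y')

variable {C : ExtendedTangentBundle n M F E}

/-- The map `T^*M → TM` of the Poisson structure, `α ↦ a(J(a^* α))`. -/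
noncomputable def ExtendedComplexStructure.poisson (J : ExtendedComplexStructure C) (x : M)
    (α : TangentSpace (𝓡 n) x →L[ℝ] ℝ) : TangentSpace (𝓡 n) x :=
  C.anchor x (J.J x (C.coanchor x α))

/-- `(M, J; ρ)` is extended Calabi–Yau: `ρ` is a smooth nowhere vanishing `d_𝒯`-closed spinor
annihilated by the `+i`-eigenbundle `L` of `J`. (As `L` is maximally isotropic, `L` is then the
whole annihilator of `ρ`.) -/
structure IsExtendedCalabiYau [T2Space M] [SigmaCompactSpace M] (s : IsotropicSplitting C)
    (J : ExtendedComplexStructure C) (ρ : MixedDForm n M) : Prop where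
  smooth : IsSmoothMixed ρ
  nonvanishing : ∀ x, ρ x ≠ 0
  annihilated : ∀ x, ∀ v ∈ iEigenspace (J.J x), s.cliffordComplex x v (ρ x) = 0
  closed : s.dT ρ = 0

end Complex

/-! ### Hamiltonian actions -/

section Action

variable {n d : ℕ} {M : Type*} [TopologicalSpace M] [ChartedSpace (Vec n) M]
  [IsManifold (𝓡 n) ∞ M]
  {F : Type*} [NormedAddCommGroup F] [NormedSpace ℝ F]
  {E : M → Type*} [TopologicalSpace (TotalSpace F E)] [∀ x, TopologicalSpace (E x)]
  [∀ x, AddCommGroup (E x)] [∀ x, Module ℝ (E x)] [∀ x, IsTopologicalAddGroup (E x)]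
  [∀ x, ContinuousSMul ℝ (E x)] [FiberBundle F E] [VectorBundle ℝ F E]
  (G : Type*) [TopologicalSpace G] [ChartedSpace (Vec d) G] [Group G] [MulAction G M]

/-- An action of `G` on `E` by extended symmetries: a smooth lift of the action on `M` to an action
by automorphisms of the Courant algebroid, which is generated by a linear map `δ : 𝔤 → Γ(E)`, in
the sense that `d/dt|_{t=0} exp(tτ)^* Y = δ(τ) * Y` for all sections `Y`. -/
structure ExtendedAction (C : ExtendedTangentBundle n M F E) where
  /-- the action on the fibres -/
  lift : (g : G) → (x : M) → E x ≃ₗ[ℝ] E (g • x)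
  lift_mul : ∀ (g h : G) (x : M) (v : E x),
    TotalSpace.mk' F (g • h • x) (lift g (h • x) (lift h x v)) =
      TotalSpace.mk' F ((g * h) • x) (lift (g * h) x v)
  lift_smooth : ContMDiff ((𝓡 d).prod ((𝓡 n).prod 𝓘(ℝ, F))) ((𝓡 n).prod 𝓘(ℝ, F)) ∞
    (fun p : G × TotalSpace F E =>
      TotalSpace.mk' F (E := E) (p.1 • p.2.proj) (lift p.1 p.2.proj p.2.snd))
  lift_pairing : ∀ g x v w, C.pairing (g • x) (lift g x v) (lift g x w) = C.pairing x v w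
  lift_anchor : ∀ g x v,
    C.anchor (g • x) (lift g x v) = mfderiv (𝓡 n) (𝓡 n) (fun y => g • y) x (C.anchor x v)
  lift_bracket : ∀ (g : G) (Y Z Y' Z' : Cₛ^∞⟮𝓡 n; F, E⟯),
    (∀ x, Y' (g • x) = lift g x (Y x)) → (∀ x, Z' (g • x) = lift g x (Z x)) →
      ∀ x, C.bracket Y' Z' (g • x) = lift g x (C.bracket Y Z x)
  /-- the sections of `E` generating the action -/
  δ : GroupLieAlgebra (𝓡 d) G →ₗ[ℝ] Cₛ^∞⟮𝓡 n; F, E⟯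
  /-- The derivative is that of a curve in the fixed fibre `E_x`, which is identified with the
  model fibre by the preferred trivialization. -/
  generates : ∀ (τ : GroupLieAlgebra (𝓡 d) G) (Y : Cₛ^∞⟮𝓡 n; F, E⟯) (x : M),
    mfderiv (𝓡 d) 𝓘(ℝ, F)
      (fun g : G => (trivializationAt F E x).continuousLinearMapAt ℝ x
        ((lift g x).symm (Y (g • x)))) 1 τ =
      (trivializationAt F E x).continuousLinearMapAt ℝ x (C.bracket (δ τ) Y x)

variable {G} in
/-- The adjoint action of `G` on its Lie algebra. -/
noncomputable def adjoint (g : G) (τ : GroupLieAlgebra (𝓡 d) G) : GroupLieAlgebra (𝓡 d) G :=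
  mfderiv (𝓡 d) (𝓡 d) (fun h : G => g * h * g⁻¹) 1 τ

variable {G} {C : ExtendedTangentBundle n M F E}

/-- The extended action is Hamiltonian with moment map `μ : M → 𝔤^*`: `μ` is smooth and
equivariant, the action on `M` is Hamiltonian with moment map `μ` for the Poisson structure of `J`,
and the extended action is generated by `J(dμ)`. -/
structure IsHamiltonian (J : ExtendedComplexStructure C) (A : ExtendedAction (d := d) G C)
    (μ : M → Module.Dual ℝ (GroupLieAlgebra (𝓡 d) G)) : Prop where
  smooth : ∀ τ, ContMDiff (𝓡 n) 𝓘(ℝ, ℝ) ∞ (fun x => μ x τ)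
  equivariant : ∀ (g : G) (x : M) (τ : GroupLieAlgebra (𝓡 d) G),
    μ (g • x) τ = μ x (adjoint g⁻¹ τ)
  geometric : ∀ (τ : GroupLieAlgebra (𝓡 d) G) (x : M),
    mfderiv (𝓡 d) (𝓡 n) (fun g : G => g • x) 1 τ =
      J.poisson x (mfderiv (𝓡 n) 𝓘(ℝ, ℝ) (fun y => μ y τ) x)
  extended : ∀ (τ : GroupLieAlgebra (𝓡 d) G) (x : M),
    A.δ τ x = J.J x (C.coanchor x (mfderiv (𝓡 n) 𝓘(ℝ, ℝ) (fun y => μ y τ) x))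

end Action

/-! ### The extended equivariant Cartan complex -/

section Equivariant

variable {n : ℕ} {M : Type*} [TopologicalSpace M] [ChartedSpace (Vec n) M]

variable (n M) in
/-- Formal power series `∑ m, u^m θ_m` in the coordinates `u_j` of `𝔤` (with respect to a basis
indexed by `ι`), with coefficients `θ_m` mixed complex forms. -/
abbrev EquivariantForm (ι : Type*) : Type _ := (ι →₀ ℕ) → MixedDForm n M

variable {ι : Type*}

/-- Multiplication by the variable `u_j`. -/
noncomputable def mulVar (j : ι) (θ : EquivariantForm n M ι) : EquivariantForm n M ι :=
  fun m => if m j = 0 then 0 else θ (m - Finsupp.single j 1)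

/-- The equivariant form `e^{-iμ} ρ`, where `μ = ∑ j, u_j μ_j` and `μ_j` is the component of `μ`
along the basis vector `b_j`: the coefficient of `u^m` is `∏ j, (-i μ_j)^{m_j} / m_j!` times `ρ`. -/
noncomputable def expMoment [Fintype ι] {𝔤 : Type*} [AddCommGroup 𝔤] [Module ℝ 𝔤]
    (b : Module.Basis ι ℝ 𝔤) (μ : M → Module.Dual ℝ 𝔤) (ρ : MixedDForm n M) :
    EquivariantForm n M ι :=
  fun m x => (∏ j, (-Complex.I * (μ x (b j) : ℂ)) ^ m j / ((m j).factorial : ℂ)) • ρ x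

variable [IsManifold (𝓡 n) ∞ M] [T2Space M] [SigmaCompactSpace M]
  {F : Type*} [NormedAddCommGroup F] [NormedSpace ℝ F]
  {E : M → Type*} [TopologicalSpace (TotalSpace F E)] [∀ x, TopologicalSpace (E x)]
  [∀ x, AddCommGroup (E x)] [∀ x, Module ℝ (E x)] [∀ x, IsTopologicalAddGroup (E x)]
  [∀ x, ContinuousSMul ℝ (E x)] [FiberBundle F E] [VectorBundle ℝ F E]
  {C : ExtendedTangentBundle n M F E} [Fintype ι] {𝔤 : Type*} [AddCommGroup 𝔤] [Module ℝ 𝔤]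

/-- The equivariant differential `d_{𝒯,δ} = d_𝒯 - ∑ j, u_j ι_{δ(τ_j)}`. -/
noncomputable def equivariantD (s : IsotropicSplitting C) (δ : 𝔤 →ₗ[ℝ] Cₛ^∞⟮𝓡 n; F, E⟯)
    (b : Module.Basis ι ℝ 𝔤) (θ : EquivariantForm n M ι) : EquivariantForm n M ι :=
  fun m => s.dT (θ m) - ∑ j, mulVar j (fun m' => s.iota (δ (b j)) (θ m')) m

/-- The extended equivariant Cartan complex: the formal power series `θ` with smooth coefficients
such that `L_{δ(τ)} θ(τ) = 0`, i.e. `∑ j, u_j L_{δ(τ_j)} θ = 0`. -/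
def cartanComplex (s : IsotropicSplitting C) (δ : 𝔤 →ₗ[ℝ] Cₛ^∞⟮𝓡 n; F, E⟯)
    (b : Module.Basis ι ℝ 𝔤) : Set (EquivariantForm n M ι) :=
  {θ | (∀ m, IsSmoothMixed (θ m)) ∧ ∀ m, ∑ j, mulVar j (fun m' => s.lieT (δ (b j)) (θ m')) m = 0}

end Equivariant

end ExtendedManifold

open ExtendedManifold

/-! Everything follows from one Clifford identity. For a covector $\xi$, the element
$a^*\xi-i\mathcal J a^*\xi$ lies in $L$, so it kills $\rho$; hence $\iota_{\mathcal J
a^*\xi}\rho=-i\,\xi\wedge\rho$ (`cliffordHom_J_coanchor`). With $\delta(\tau)=\mathcal J d\mu_\tau$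
this reads $\iota_{\delta(\tau)}\rho=-i\,d\mu_\tau\wedge\rho$.

Isotropy: $\mathcal J$ is orthogonal and $a^*(T^*M)$ is isotropic.

Closedness: since $d_{\mathcal T}\rho=0$, the Leibniz rule gives $d_{\mathcal
T}(e^{-i\mu}\rho)=-i\sum_j u_j\,d\mu_j\wedge e^{-i\mu}\rho$, which is $\sum_j
u_j\iota_{\delta(\tau_j)}\rho_G$ by the identity (`dT_smul`, `hasFDerivAt_expCoeff`).

Membership in the Cartan complex: a Cartan-type formula applied to $\rho$ gives $\mathcal
L^{\mathcal T}_{\delta(\tau)}\rho=d_{\mathcal T}(-i\,d\mu_\tau\wedge\rho)=0$ (`lieT_eq_zero`). Hence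
$\mathcal L^{\mathcal T}_{\delta(\tau_j)}$ acts on $\rho_G$ only through derivatives of $e^{-i\mu}$
along $X_j=a(\delta(\tau_j))$, and $\sum_j u_j\mathcal L^{\mathcal
T}_{\delta(\tau_j)}\rho_G=-i\sum_{j,k}u_ju_k\,d\mu_k(X_j)\,\rho_G$. This vanishes because
$d\mu_k(X_j)$ is antisymmetric in $j,k$ (`poisson_antisymm`, `sum_sum_ite_mul_antisymm`).

The analysis is done on $\mathbb R^n$ in the preferred chart at each point, whose derivative at that
point is the identity; the core computation there is `localLieD_add_wedge_eq_zero`. -/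

namespace ExtendedManifold

/-! ### Exterior and Clifford algebra on $\mathbb R^n$. -/

section LinearAlgebra

variable {n : ℕ}

noncomputable instance : AddCommGroup (MixedForm n) := inferInstance

noncomputable instance instModuleRealMixedForm : Module ℝ (MixedForm n) := inferInstance

noncomputable instance instModuleComplexMixedForm : Module ℂ (MixedForm n) := inferInstance

noncomputable instance : DistribMulAction ℝ (MixedForm n) :=
  instModuleRealMixedForm.toDistribMulAction

noncomputable instance : DistribMulAction ℂ (MixedForm n) :=
  instModuleComplexMixedForm.toDistribMulAction

noncomputable instance (k : ℕ) : NormedAddCommGroup (Vec n [⋀^Fin k]→L[ℝ] ℂ) := inferInstance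

noncomputable instance (k : ℕ) : NormedSpace ℝ (Vec n [⋀^Fin k]→L[ℝ] ℂ) := inferInstance

noncomputable instance (k : ℕ) : NormedAddCommGroup (Vec n →L[ℝ] Vec n [⋀^Fin k]→L[ℝ] ℂ) :=
  inferInstance

noncomputable instance (k : ℕ) : NormedSpace ℝ (Vec n →L[ℝ] Vec n [⋀^Fin k]→L[ℝ] ℂ) :=
  inferInstance

theorem covectorWedge_succ_apply (ξ : Vec n →L[ℝ] ℝ) (θ : MixedForm n) (k : ℕ)
    (v : Fin (k + 1) → Vec n) :
    covectorWedge ξ θ (k + 1) v =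
      ∑ i : Fin (k + 1), (-1) ^ (i : ℕ) • (ξ (v i) • θ k (i.removeNth v)) := by
  simp [covectorWedge, ContinuousAlternatingMap.alternatizeUncurryFin_apply]

@[simp]
theorem covectorWedge_zero_left (θ : MixedForm n) : covectorWedge 0 θ = 0 := by
  simpa using covectorWedge_smul_left 0 0 θ

/-- Exterior multiplication by a covector, as a linear map. -/
noncomputable def covectorWedgeLinear (ξ : Vec n →L[ℝ] ℝ) : MixedForm n →ₗ[ℂ] MixedForm n where
  toFun := covectorWedge ξ
  map_add' := covectorWedge_add_right ξ
  map_smul' c := covectorWedge_smul_right c ξ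

/-- Contraction with a vector, as a linear map. -/
noncomputable def contractLinear (v : Vec n) : MixedForm n →ₗ[ℂ] MixedForm n where
  toFun := contract v
  map_add' := contract_add_right v
  map_smul' c := contract_smul_right c v

theorem covectorWedge_neg_right (ξ : Vec n →L[ℝ] ℝ) (θ : MixedForm n) :
    covectorWedge ξ (-θ) = -covectorWedge ξ θ :=
  map_neg (covectorWedgeLinear ξ) θ

theorem covectorWedge_sum_right {κ : Type*} (s : Finset κ) (ξ : Vec n →L[ℝ] ℝ)
    (θ : κ → MixedForm n) :
    covectorWedge ξ (∑ i ∈ s, θ i) = ∑ i ∈ s, covectorWedge ξ (θ i) :=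
  map_sum (covectorWedgeLinear ξ) θ s

theorem covectorWedge_real_smul_right (c : ℝ) (ξ : Vec n →L[ℝ] ℝ) (θ : MixedForm n) :
    covectorWedge ξ (c • θ) = c • covectorWedge ξ θ :=
  (covectorWedgeLinear ξ).map_smul_of_tower c θ

theorem contract_real_smul_right (c : ℝ) (v : Vec n) (θ : MixedForm n) :
    contract v (c • θ) = c • contract v θ :=
  (contractLinear v).map_smul_of_tower c θ

theorem contract_sum_right {κ : Type*} (s : Finset κ) (v : Vec n) (θ : κ → MixedForm n) :
    contract v (∑ i ∈ s, θ i) = ∑ i ∈ s, contract v (θ i) :=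
  map_sum (contractLinear v) θ s

theorem covectorWedge_sum_left {κ : Type*} (s : Finset κ) (ξ : κ → Vec n →L[ℝ] ℝ)
    (θ : MixedForm n) :
    covectorWedge (∑ i ∈ s, ξ i) θ = ∑ i ∈ s, covectorWedge (ξ i) θ := by
  classical
  induction s using Finset.induction_on with
  | empty => simp
  | insert a s ha ih => rw [Finset.sum_insert ha, Finset.sum_insert ha, covectorWedge_add_left, ih]

/-- In degrees at least two this is the algebra behind $d^2=0$: alternatizing twice kills
$\xi\otimes\xi\otimes\theta$, which is symmetric in its first two slots. -/
theorem covectorWedge_self (ξ : Vec n →L[ℝ] ℝ) (θ : MixedForm n) :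
    covectorWedge ξ (covectorWedge ξ θ) = 0 := by
  funext k
  match k with
  | 0 => rfl
  | 1 =>
    have h : covectorWedge ξ θ 0 = 0 := rfl
    ext v
    simp [covectorWedge_succ_apply, h]
  | k + 2 =>
    have h := ContinuousAlternatingMap.alternatizeUncurryFin_alternatizeUncurryFinCLM_comp_of_symmetric
      (𝕜 := ℝ) (E := Vec n) (F := ℂ) (n := k)
      (f := ξ.smulRight (ξ.smulRight (θ k))) (fun x y => by
        simp [smul_smul, mul_comm])
    rw [Pi.zero_apply, ← h]
    simp only [covectorWedge]
    congr 1
    ext x v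
    simp [ContinuousAlternatingMap.alternatizeUncurryFin_apply, Finset.mul_sum, mul_left_comm]

/-- Polarization of `covectorWedge_self`. -/
theorem covectorWedge_anticomm (ξ η : Vec n →L[ℝ] ℝ) (θ : MixedForm n) :
    covectorWedge ξ (covectorWedge η θ) = -covectorWedge η (covectorWedge ξ θ) := by
  have h := covectorWedge_self (ξ + η) θ
  simp only [covectorWedge_add_left, covectorWedge_add_right, covectorWedge_self, zero_add,
    add_zero] at h
  exact eq_neg_of_add_eq_zero_right h

theorem contract_covectorWedge (v : Vec n) (ξ : Vec n →L[ℝ] ℝ) (θ : MixedForm n) :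
    contract v (covectorWedge ξ θ) = ξ v • θ - covectorWedge ξ (contract v θ) := by
  funext k
  ext w
  cases k with
  | zero => simp [contract, covectorWedge, ContinuousAlternatingMap.alternatizeUncurryFin_apply]
  | succ k =>
    change covectorWedge ξ θ (k + 1 + 1) (Matrix.vecCons v w) =
      ξ v • θ (k + 1) w - covectorWedge ξ (contract v θ) (k + 1) w
    -- The term $i=0$ feeds $v$ to $\xi$; in the others $v$ stays in $\theta$, and the index shift
    -- supplies the minus sign.
    rw [covectorWedge_succ_apply, covectorWedge_succ_apply, Fin.sum_univ_succ, sub_eq_add_neg,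
      ← Finset.sum_neg_distrib]
    congr 1
    · simp
    · refine Finset.sum_congr rfl fun i _ => ?_
      have : (i.succ.removeNth (Matrix.vecCons v w) : Fin (k + 1) → Vec n) =
          Matrix.vecCons v (i.removeNth w) := by
        funext j
        refine Fin.cases ?_ (fun j => ?_) j <;> simp [Fin.removeNth, Matrix.vecCons]
      rw [this]
      simp [contract, pow_succ]

theorem sum_fin_succ_arrow {A B : Type*} [Fintype A] [AddCommMonoid B] {p : ℕ}
    (g : (Fin (p + 1) → A) → B) : ∑ f, g f = ∑ a, ∑ f : Fin p → A, g (Fin.cons a f) := by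
  rw [← Fintype.sum_prod_type', ← (Fin.consEquiv fun _ => A).sum_comp]
  rfl

theorem wedge_zero (α : Vec n [⋀^Fin 0]→L[ℝ] ℝ) (θ : MixedForm n) : wedge α θ = α ![] • θ := by
  simp only [wedge, Nat.factorial_zero, Nat.cast_one, inv_one, one_smul, Fintype.sum_unique,
    List.ofFn_zero, List.foldr_nil]
  congr
  exact Subsingleton.elim _ _

/-- The recursion $\alpha=\frac1{p+1}\sum_i e^i\wedge\iota_{e_i}\alpha$. It replaces sums over
multi-indices by induction on the degree of $\alpha$, so that properties of `wedge` reduce to those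
of `covectorWedge`. -/
theorem wedge_succ {p : ℕ} (α : Vec n [⋀^Fin (p + 1)]→L[ℝ] ℝ) (θ : MixedForm n) :
    wedge α θ = ((p + 1 : ℝ)⁻¹) • ∑ i : Fin n, covectorWedge (EuclideanSpace.proj i)
      (wedge (α.curryLeft (EuclideanSpace.single i (1 : ℝ))) θ) := by
  simp only [wedge, sum_fin_succ_arrow, covectorWedge_real_smul_right, covectorWedge_sum_right]
  rw [← Finset.smul_sum, smul_smul]
  congr 1
  · rw [Nat.factorial_succ]; push_cast; rw [mul_inv]
  refine Finset.sum_congr rfl fun i _ => Finset.sum_congr rfl fun f _ => ?_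
  congr 1
  · rw [ContinuousAlternatingMap.curryLeft_apply_apply]
    congr 1
    funext j
    refine Fin.cases ?_ (fun j => ?_) j <;> simp [Matrix.vecCons]
  · simp

theorem wedge_add_left {p : ℕ} (α β : Vec n [⋀^Fin p]→L[ℝ] ℝ) (θ : MixedForm n) :
    wedge (α + β) θ = wedge α θ + wedge β θ := by
  simp only [wedge, ContinuousAlternatingMap.add_apply, add_smul, Finset.sum_add_distrib, smul_add]

theorem wedge_smul_left {p : ℕ} (c : ℝ) (α : Vec n [⋀^Fin p]→L[ℝ] ℝ) (θ : MixedForm n) :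
    wedge (c • α) θ = c • wedge α θ := by
  simp only [wedge, ContinuousAlternatingMap.smul_apply, smul_assoc, ← Finset.smul_sum]
  rw [smul_comm]

theorem wedge_neg_left {p : ℕ} (α : Vec n [⋀^Fin p]→L[ℝ] ℝ) (θ : MixedForm n) :
    wedge (-α) θ = -wedge α θ := by
  rw [← neg_one_smul ℝ α, wedge_smul_left, neg_one_smul]

theorem wedge_sub_left {p : ℕ} (α β : Vec n [⋀^Fin p]→L[ℝ] ℝ) (θ : MixedForm n) :
    wedge (α - β) θ = wedge α θ - wedge β θ := by
  rw [sub_eq_add_neg, wedge_add_left, wedge_neg_left, sub_eq_add_neg]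

theorem wedge_add_right {p : ℕ} (α : Vec n [⋀^Fin p]→L[ℝ] ℝ) (θ η : MixedForm n) :
    wedge α (θ + η) = wedge α θ + wedge α η := by
  induction p with
  | zero => simp only [wedge_zero, smul_add]
  | succ p ih =>
    simp only [wedge_succ, ih, covectorWedge_add_right, Finset.sum_add_distrib, smul_add]

theorem wedge_smul_right {p : ℕ} (c : ℂ) (α : Vec n [⋀^Fin p]→L[ℝ] ℝ) (θ : MixedForm n) :
    wedge α (c • θ) = c • wedge α θ := by
  induction p with
  | zero => simp only [wedge_zero]; rw [smul_comm]
  | succ p ih =>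
    simp only [wedge_succ, ih, covectorWedge_smul_right, ← Finset.smul_sum]
    rw [smul_comm]

theorem covectorWedge_wedge {p : ℕ} (ξ : Vec n →L[ℝ] ℝ) (α : Vec n [⋀^Fin p]→L[ℝ] ℝ)
    (θ : MixedForm n) :
    covectorWedge ξ (wedge α θ) = (-1 : ℝ) ^ p • wedge α (covectorWedge ξ θ) := by
  induction p with
  | zero => simp [wedge_zero, covectorWedge_real_smul_right]
  | succ p ih =>
    simp only [wedge_succ, covectorWedge_real_smul_right, covectorWedge_sum_right]
    rw [smul_comm ((-1 : ℝ) ^ (p + 1))]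
    congr 1
    rw [Finset.smul_sum]
    refine Finset.sum_congr rfl fun i _ => ?_
    rw [covectorWedge_anticomm, ih, covectorWedge_real_smul_right, pow_succ, mul_neg_one, neg_smul]

theorem sum_smul_single (v : Vec n) : ∑ i : Fin n, v i • EuclideanSpace.single i (1 : ℝ) = v := by
  ext j
  rw [WithLp.ofLp_sum, Finset.sum_apply]
  simp

theorem sum_smul_curryLeft {p : ℕ} (α : Vec n [⋀^Fin (p + 1)]→L[ℝ] ℝ) (v : Vec n) :
    ∑ i : Fin n, v i • α.curryLeft (EuclideanSpace.single i (1 : ℝ)) = α.curryLeft v := by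
  conv_rhs => rw [← sum_smul_single v]
  rw [map_sum]
  simp only [map_smul]

theorem wedge_sum_left {κ : Type*} (s : Finset κ) {p : ℕ} (α : κ → Vec n [⋀^Fin p]→L[ℝ] ℝ)
    (θ : MixedForm n) : wedge (∑ i ∈ s, α i) θ = ∑ i ∈ s, wedge (α i) θ := by
  classical
  induction s using Finset.induction_on with
  | empty => simpa using wedge_smul_left 0 (0 : Vec n [⋀^Fin p]→L[ℝ] ℝ) θ
  | insert a s ha ih => rw [Finset.sum_insert ha, Finset.sum_insert ha, wedge_add_left, ih]

theorem curryLeft_curryLeft_swap {p : ℕ} (α : Vec n [⋀^Fin (p + 2)]→L[ℝ] ℝ) (v w : Vec n) :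
    (α.curryLeft v).curryLeft w = -(α.curryLeft w).curryLeft v := by
  have h : ∀ u, (α.curryLeft u).curryLeft u = 0 := fun u => by
    ext x
    exact α.map_eq_zero_of_eq _ (i := 0) (j := 1) (by simp) (by simp)
  have := h (v + w)
  simp only [map_add, ContinuousAlternatingMap.curryLeft_add, add_apply, h, zero_add,
    add_zero] at this
  exact eq_neg_of_add_eq_zero_right this

/-- Contraction with a vector is a graded derivation of the exterior product. -/
theorem contract_wedge {p : ℕ} (v : Vec n) (α : Vec n [⋀^Fin (p + 1)]→L[ℝ] ℝ) (θ : MixedForm n) :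
    contract v (wedge α θ) =
      wedge (α.curryLeft v) θ + (-1 : ℝ) ^ (p + 1) • wedge α (contract v θ) := by
  have hv : ∑ i : Fin n, v i • wedge (α.curryLeft (EuclideanSpace.single i (1 : ℝ))) θ =
      wedge (α.curryLeft v) θ := by
    rw [← sum_smul_curryLeft α v, wedge_sum_left]
    simp only [wedge_smul_left]
  induction p with
  | zero =>
    simp only [wedge_succ, contract_real_smul_right, contract_sum_right, contract_covectorWedge,
      Finset.sum_sub_distrib] at hv ⊢
    simp only [wedge_zero, contract_real_smul_right] at hv ⊢
    simp only [PiLp.proj_apply, hv]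
    simp [sub_eq_add_neg]
  | succ p ih =>
    -- In each summand of the recursion the contraction either hits $e^i$, or passes it with a sign
    -- and falls under the induction hypothesis for $\iota_{e_i}\alpha$.
    have key : ∀ i : Fin n, contract v (covectorWedge (EuclideanSpace.proj i)
        (wedge (α.curryLeft (EuclideanSpace.single i (1 : ℝ))) θ)) =
        v i • wedge (α.curryLeft (EuclideanSpace.single i (1 : ℝ))) θ +
        (covectorWedge (EuclideanSpace.proj i)
          (wedge ((α.curryLeft v).curryLeft (EuclideanSpace.single i (1 : ℝ))) θ) +
        (-1 : ℝ) ^ (p + 2) • covectorWedge (EuclideanSpace.proj i)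
          (wedge (α.curryLeft (EuclideanSpace.single i (1 : ℝ))) (contract v θ))) := fun i => by
      rw [contract_covectorWedge, ih, covectorWedge_add_right, covectorWedge_real_smul_right,
        curryLeft_curryLeft_swap, wedge_neg_left, covectorWedge_neg_right, pow_succ _ (p + 1)]
      · simp; abel
      · rw [← sum_smul_curryLeft _ v, wedge_sum_left]
        simp only [wedge_smul_left]
    rw [wedge_succ α θ, wedge_succ α (contract v θ), contract_real_smul_right, contract_sum_right]
    simp only [key, Finset.sum_add_distrib, hv, ← Finset.smul_sum]
    -- Read backwards, the recursion turns $\sum_i e^i\wedge\iota_{e_i}\iota_v\alpha\wedge\theta$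
    -- into $p+1$ copies of $\iota_v\alpha\wedge\theta$. With the copy from `hv` there are $p+2$,
    -- which cancels the prefactor.
    have h2 := wedge_succ (α.curryLeft v) θ
    rw [eq_inv_smul_iff₀ (by positivity)] at h2
    rw [← h2, smul_add, smul_add, smul_comm _ ((-1 : ℝ) ^ (p + 2)), ← add_assoc, ← smul_add]
    congr 1
    rw [inv_smul_eq_iff₀ (by positivity)]
    push_cast
    module

theorem wedge_two (α : Vec n [⋀^Fin 2]→L[ℝ] ℝ) (θ : MixedForm n) :
    wedge α θ = (2⁻¹ : ℝ) • ∑ i : Fin n, ∑ j : Fin n,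
      α ![EuclideanSpace.single i (1 : ℝ), EuclideanSpace.single j (1 : ℝ)] •
        covectorWedge (EuclideanSpace.proj i) (covectorWedge (EuclideanSpace.proj j) θ) := by
  simp only [wedge_succ, wedge_zero, covectorWedge_real_smul_right, covectorWedge_sum_right]
  simp [one_add_one_eq_two]

/-- As 3 is odd, contraction and covector multiplication pass $\alpha$ with the same sign. The
defect $\iota_v\alpha$ is the source of the term $-\iota_XH$ in $\mathcal L^{\mathcal T}_{\mathfrak
X}$. -/
theorem clifford_wedge_three (v : Vec n) (ξ : Vec n →L[ℝ] ℝ) (α : Vec n [⋀^Fin 3]→L[ℝ] ℝ)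
    (θ : MixedForm n) :
    clifford v ξ (wedge α θ) = wedge (α.curryLeft v) θ - wedge α (clifford v ξ θ) := by
  simp only [clifford, wedge_add_right]
  rw [contract_wedge, covectorWedge_wedge]
  norm_num
  abel

end LinearAlgebra

/-! ### Exterior derivative and Cartan's formula on $\mathbb R^n$. -/

section Calculus

open Filter Topology

variable {n : ℕ}

/-- The exterior derivative of a form of mixed degree on `ℝⁿ`. -/
noncomputable def localD (θ : Vec n → MixedForm n) (y : Vec n) : MixedForm n
  | 0 => 0
  | k + 1 => extDeriv (fun z => θ z k) y

/-- Smoothness at a point of a form of mixed degree on `ℝⁿ`. -/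
def SmoothMixedAt (θ : Vec n → MixedForm n) (p : Vec n) : Prop :=
  ∀ k, ContDiffAt ℝ ∞ (fun y => θ y k) p

variable {θ η : Vec n → MixedForm n} {p : Vec n}

theorem SmoothMixedAt.differentiableAt (h : SmoothMixedAt θ p) (k : ℕ) :
    DifferentiableAt ℝ (fun y => θ y k) p :=
  (h k).differentiableAt (by simp)

theorem SmoothMixedAt.add (hθ : SmoothMixedAt θ p) (hη : SmoothMixedAt η p) :
    SmoothMixedAt (fun y => θ y + η y) p := fun k => (hθ k).add (hη k)

theorem SmoothMixedAt.smul {f : Vec n → ℂ} (hf : ContDiffAt ℝ ∞ f p) (hθ : SmoothMixedAt θ p) :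
    SmoothMixedAt (fun y => f y • θ y) p := fun k => hf.smul (hθ k)

theorem SmoothMixedAt.sum {κ : Type*} {s : Finset κ} {θ : κ → Vec n → MixedForm n}
    (h : ∀ i ∈ s, SmoothMixedAt (θ i) p) : SmoothMixedAt (fun y => ∑ i ∈ s, θ i y) p := fun k => by
  simp only [Finset.sum_apply]
  exact ContDiffAt.sum fun i hi => h i hi k

theorem SmoothMixedAt.localD (h : SmoothMixedAt θ p) : SmoothMixedAt (localD θ) p := fun k =>
  match k with
  | 0 => contDiffAt_const
  | k + 1 => (ContinuousAlternatingMap.alternatizeUncurryFinCLM ℝ (Vec n) ℂ).contDiff.contDiffAt.comp p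
      ((h k).fderiv_right (m := ∞) (by simp))

theorem SmoothMixedAt.covectorWedge {ξ : Vec n → Vec n →L[ℝ] ℝ} (hξ : ContDiffAt ℝ ∞ ξ p)
    (h : SmoothMixedAt θ p) : SmoothMixedAt (fun y => covectorWedge (ξ y) (θ y)) p := fun k =>
  match k with
  | 0 => contDiffAt_const
  | k + 1 => (ContinuousAlternatingMap.alternatizeUncurryFinCLM ℝ (Vec n) ℂ).contDiff.contDiffAt.comp p
      (hξ.smulRight (h k))

/-- The neighbourhood may depend on the degree, since each component of `localD` involves only one
component of the form. -/
theorem localD_congr (h : ∀ k, (fun y => θ y k) =ᶠ[𝓝 p] fun y => η y k) :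
    localD θ p = localD η p := by
  funext k
  cases k with
  | zero => rfl
  | succ k => exact (h k).extDeriv_eq

theorem localD_add (hθ : SmoothMixedAt θ p) (hη : SmoothMixedAt η p) :
    localD (fun y => θ y + η y) p = localD θ p + localD η p := by
  funext k
  cases k with
  | zero => simp [localD]
  | succ k => exact extDeriv_fun_add (hθ.differentiableAt k) (hη.differentiableAt k)

theorem localD_zero : localD (fun _ => (0 : MixedForm n)) p = 0 := by
  funext k
  cases k with
  | zero => rfl
  | succ k =>
    ext v
    simp [localD, extDeriv, ContinuousAlternatingMap.alternatizeUncurryFin_apply]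

theorem localD_sum {κ : Type*} (s : Finset κ) {θ : κ → Vec n → MixedForm n}
    (h : ∀ i ∈ s, SmoothMixedAt (θ i) p) :
    localD (fun y => ∑ i ∈ s, θ i y) p = ∑ i ∈ s, localD (θ i) p := by
  classical
  induction s using Finset.induction_on with
  | empty => simpa using localD_zero
  | insert a s ha ih =>
    simp only [Finset.sum_insert ha]
    rw [localD_add (h a (by simp)) (.sum fun i hi => h i (by simp [hi])),
      ih fun i hi => h i (by simp [hi])]

/-- `covectorWedge` takes real covectors, so the differential of a complex function enters as a
complex combination of real ones. Working in a single degree requires differentiability of one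
component only, which is what is available at points near $p$. -/
theorem localD_smul_succ {κ : Type*} [Fintype κ] {f : Vec n → ℂ} {c : κ → ℂ}
    {ξ : κ → Vec n →L[ℝ] ℝ} (hf : HasFDerivAt f (∑ j, c j • Complex.ofRealCLM.comp (ξ j)) p)
    {k : ℕ} (hθ : DifferentiableAt ℝ (fun y => θ y k) p) :
    localD (fun y => f y • θ y) p (k + 1) =
      (∑ j, c j • covectorWedge (ξ j) (θ p) + f p • localD θ p) (k + 1) := by
  ext v
  have h : fderiv ℝ (fun y => f y • θ y k) p = _ := (hf.smul hθ.hasFDerivAt).fderiv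
  rw [Pi.add_apply, Finset.sum_apply]
  simp only [localD, extDeriv, Pi.smul_apply]
  rw [h]
  simp only [ContinuousAlternatingMap.alternatizeUncurryFin_apply, covectorWedge_succ_apply,
    ContinuousAlternatingMap.sum_apply, ContinuousAlternatingMap.add_apply,
    ContinuousAlternatingMap.smul_apply, add_apply, smul_apply, sum_apply,
    ContinuousLinearMap.smulRight_apply, smul_add, Finset.sum_add_distrib, Finset.smul_sum,
    Finset.sum_smul, ContinuousLinearMap.comp_apply]
  rw [Finset.sum_comm, add_comm]
  congr 1
  · refine Finset.sum_congr rfl fun i _ => Finset.sum_congr rfl fun j _ => ?_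
    simp
    ring
  · refine Finset.sum_congr rfl fun i _ => ?_
    simp
    ring

theorem localD_smul {κ : Type*} [Fintype κ] {f : Vec n → ℂ} {c : κ → ℂ}
    {ξ : κ → Vec n →L[ℝ] ℝ} (hf : HasFDerivAt f (∑ j, c j • Complex.ofRealCLM.comp (ξ j)) p)
    (hθ : SmoothMixedAt θ p) :
    localD (fun y => f y • θ y) p = ∑ j, c j • covectorWedge (ξ j) (θ p) + f p • localD θ p := by
  funext k
  cases k with
  | zero => simp [localD, covectorWedge, Finset.sum_apply]
  | succ k => exact localD_smul_succ hf (hθ.differentiableAt k)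

theorem hasFDerivAt_ofReal_comp {g : Vec n → ℝ} (hg : DifferentiableAt ℝ g p) :
    HasFDerivAt (fun y => (g y : ℂ)) (∑ _ : Unit, (1 : ℂ) • Complex.ofRealCLM.comp (fderiv ℝ g p))
      p := by
  rw [Fintype.sum_unique, one_smul]
  exact Complex.ofRealCLM.hasFDerivAt.comp p hg.hasFDerivAt

theorem localD_ofReal_smul_succ {g : Vec n → ℝ} (hg : DifferentiableAt ℝ g p) {k : ℕ}
    (hθ : DifferentiableAt ℝ (fun y => θ y k) p) :
    localD (fun y => (g y : ℂ) • θ y) p (k + 1) =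
      (covectorWedge (fderiv ℝ g p) (θ p) + (g p : ℂ) • localD θ p) (k + 1) := by
  simpa using localD_smul_succ (hasFDerivAt_ofReal_comp hg) hθ

theorem localD_ofReal_smul {g : Vec n → ℝ} (hg : DifferentiableAt ℝ g p)
    (hθ : SmoothMixedAt θ p) :
    localD (fun y => (g y : ℂ) • θ y) p =
      covectorWedge (fderiv ℝ g p) (θ p) + (g p : ℂ) • localD θ p := by
  simpa using localD_smul (hasFDerivAt_ofReal_comp hg) hθ

theorem localD_localD (hθ : SmoothMixedAt θ p) : localD (localD θ) p = 0 := by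
  funext k
  match k with
  | 0 => rfl
  | 1 => exact congrFun (localD_zero (p := p)) 1
  | k + 2 =>
    exact extDeriv_extDeriv_apply (hθ k) (by rw [minSmoothness_of_isRCLikeNormedField]; exact WithTop.coe_le_coe.2 le_top)

/-- Obtained from $0=d^2(g\theta)=d(dg\wedge\theta+g\,d\theta)$ by expanding the last term, so no
separate Leibniz computation is needed. -/
theorem localD_fderiv_wedge {g : Vec n → ℝ} (hg : ContDiffAt ℝ ∞ g p) (hθ : SmoothMixedAt θ p) :
    localD (fun y => covectorWedge (fderiv ℝ g y) (θ y)) p =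
      -covectorWedge (fderiv ℝ g p) (localD θ p) := by
  have hg' : ContDiffAt ℝ ∞ (fun y => (g y : ℂ)) p := Complex.ofRealCLM.contDiff.contDiffAt.comp p hg
  have hdg : ContDiffAt ℝ ∞ (fderiv ℝ g) p := hg.fderiv_right (by simp)
  have h₁ : SmoothMixedAt (fun y => (g y : ℂ) • localD θ y) p := .smul hg' hθ.localD
  have h₂ : SmoothMixedAt (fun y => covectorWedge (fderiv ℝ g y) (θ y)) p := .covectorWedge hdg hθ
  have h : localD (fun y => covectorWedge (fderiv ℝ g y) (θ y) + (g y : ℂ) • localD θ y) p = 0 := by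
    rw [← localD_localD (.smul hg' hθ)]
    refine localD_congr fun k => ?_
    cases k with
    | zero => exact .of_forall fun y => by simp [localD, covectorWedge]
    | succ k =>
      -- Smoothness of order $\infty$ at a point need not spread to a neighbourhood, but order 1
      -- does, and it suffices here.
      filter_upwards [(hg.of_le (m := 1) (by exact_mod_cast le_top)).eventually (by simp),
        ((hθ k).of_le (m := 1) (by exact_mod_cast le_top)).eventually (by simp)] with y h₁ h₂
      exact (localD_ofReal_smul_succ (h₁.differentiableAt (by simp))
        (h₂.differentiableAt (by simp))).symm
  rw [localD_add h₂ h₁, localD_ofReal_smul (hg.differentiableAt (by simp)) hθ.localD,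
    localD_localD hθ, smul_zero, add_zero] at h
  exact eq_neg_of_add_eq_zero_left h

/-- The exterior derivative is a graded derivation with respect to products with 1-forms. -/
theorem localD_covectorWedge {ξ : Vec n → Vec n →L[ℝ] ℝ} (hξ : ContDiffAt ℝ ∞ ξ p)
    (hθ : SmoothMixedAt θ p) :
    localD (fun y => covectorWedge (ξ y) (θ y)) p =
      wedge (extDeriv (fun y => ContinuousAlternatingMap.ofSubsingleton ℝ (Vec n) ℝ (0 : Fin 1)
        (ξ y)) p) (θ p) - covectorWedge (ξ p) (localD θ p) := by
  let e : Fin n → Vec n := fun i => EuclideanSpace.single i 1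
  let pr : Fin n → Vec n →L[ℝ] ℝ := fun i => EuclideanSpace.proj i
  have hξe : ∀ i, ContDiffAt ℝ ∞ (fun y => ξ y (e i)) p := fun i => hξ.clm_apply contDiffAt_const
  have hexp : ∀ y, ξ y = ∑ i, ξ y (e i) • pr i := fun y => by
    ext v
    conv_lhs => rw [← sum_smul_single v, map_sum]
    simp [mul_comm, e, pr]
  have hw : ∀ i, SmoothMixedAt (fun y => covectorWedge (pr i) (θ y)) p := fun i =>
    .covectorWedge contDiffAt_const hθ
  -- Each $e^i$ is the differential of a linear function, so the exact case applies; a general $\xi$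
  -- is $\sum_i\xi_i e^i$.
  have hdw : ∀ i, localD (fun y => covectorWedge (pr i) (θ y)) p =
      -covectorWedge (pr i) (localD θ p) := fun i => by
    simpa using localD_fderiv_wedge (g := pr i) (pr i).contDiff.contDiffAt hθ
  have hterm : ∀ i, SmoothMixedAt (fun y => (ξ y (e i) : ℂ) • covectorWedge (pr i) (θ y)) p :=
    fun i => .smul (Complex.ofRealCLM.contDiff.contDiffAt.comp p (hξe i)) (hw i)
  have hL : (fun y => covectorWedge (ξ y) (θ y)) =
      fun y => ∑ i, (ξ y (e i) : ℂ) • covectorWedge (pr i) (θ y) := by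
    funext y
    conv_lhs => rw [hexp y, covectorWedge_sum_left]
    refine Finset.sum_congr rfl fun i _ => ?_
    rw [covectorWedge_smul_left]
    rfl
  have hd : ∀ i j, extDeriv (fun y => ContinuousAlternatingMap.ofSubsingleton ℝ (Vec n) ℝ
      (0 : Fin 1) (ξ y)) p ![e i, e j] =
        fderiv ℝ (fun y => ξ y (e j)) p (e i) - fderiv ℝ (fun y => ξ y (e i)) p (e j) := by
    intro i j
    have hdiff : DifferentiableAt ℝ (fun y => ContinuousAlternatingMap.ofSubsingleton ℝ (Vec n) ℝ
        (0 : Fin 1) (ξ y)) p :=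
      (ContinuousAlternatingMap.ofSubsingletonLIE (𝕜 := ℝ) (E := Vec n) (F := ℝ) (0 : Fin 1)).differentiable.differentiableAt.comp p
        (hξ.differentiableAt (by simp))
    rw [extDeriv_apply hdiff]
    simp [Fin.sum_univ_two, Fin.removeNth, sub_eq_add_neg]
  rw [hL, localD_sum _ fun i _ => hterm i]
  simp only [localD_ofReal_smul ((hξe _).differentiableAt (by simp)) (hw _), hdw,
    Finset.sum_add_distrib]
  rw [sub_eq_add_neg, wedge_two]
  congr 1
  · have hW : ∀ i j, covectorWedge (pr i) (covectorWedge (pr j) (θ p)) =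
        -covectorWedge (pr j) (covectorWedge (pr i) (θ p)) := fun i j => covectorWedge_anticomm _ _ _
    have hfd : ∀ i, fderiv ℝ (fun y => ξ y (e i)) p =
        ∑ j, fderiv ℝ (fun y => ξ y (e i)) p (e j) • pr j := fun i => by
      ext v
      conv_lhs => rw [← sum_smul_single v, map_sum]
      simp [mul_comm, e, pr]
    -- The factor $\frac12$ of `wedge_two` disappears because the two halves of
    -- $\partial_i\xi_j-\partial_j\xi_i$ contribute equally, by anticommutation of $e^i$ and $e^j$.
    rw [eq_inv_smul_iff₀ two_ne_zero, two_smul]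
    change _ = ∑ i, ∑ j, extDeriv (fun y => ContinuousAlternatingMap.ofSubsingleton ℝ (Vec n) ℝ
      (0 : Fin 1) (ξ y)) p ![e i, e j] • covectorWedge (pr i) (covectorWedge (pr j) (θ p))
    simp only [hd, sub_smul, Finset.sum_sub_distrib]
    have h₁ : ∑ i, covectorWedge (fderiv ℝ (fun y => ξ y (e i)) p) (covectorWedge (pr i) (θ p)) =
        ∑ i, ∑ j, fderiv ℝ (fun y => ξ y (e i)) p (e j) •
          covectorWedge (pr j) (covectorWedge (pr i) (θ p)) := by
      refine Finset.sum_congr rfl fun i _ => ?_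
      conv_lhs => rw [hfd i]
      simp only [covectorWedge_sum_left, covectorWedge_smul_left]
    have h₂ : ∑ i, ∑ j, fderiv ℝ (fun y => ξ y (e i)) p (e j) •
          covectorWedge (pr i) (covectorWedge (pr j) (θ p)) =
        -∑ i, covectorWedge (fderiv ℝ (fun y => ξ y (e i)) p) (covectorWedge (pr i) (θ p)) := by
      rw [h₁, ← Finset.sum_neg_distrib]
      refine Finset.sum_congr rfl fun i _ => ?_
      rw [← Finset.sum_neg_distrib]
      exact Finset.sum_congr rfl fun j _ => by rw [hW i j, smul_neg]
    rw [h₂, sub_neg_eq_add, Finset.sum_comm, ← h₁]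
  · conv_rhs => rw [hexp p, covectorWedge_sum_left]
    rw [← Finset.sum_neg_distrib]
    refine Finset.sum_congr rfl fun i _ => ?_
    rw [covectorWedge_smul_left, smul_neg]
    rfl

/-- Cartan's formula. -/
theorem localLieD_eq {X : Vec n → Vec n} (hX : DifferentiableAt ℝ X p) (hθ : SmoothMixedAt θ p) :
    (fun k => localLieD X (fun y => θ y k) p : MixedForm n) =
      localD (fun y => contract (X y) (θ y)) p + contract (X p) (localD θ p) := by
  funext k
  ext v
  rw [localLieD_apply]
  have hD : contract (X p) (localD θ p) k v = ∑ i : Fin (k + 1), (-1) ^ (i : ℕ) •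
      fderiv ℝ (fun y => θ y k) p ((Matrix.vecCons (X p) v : Fin (k + 1) → Vec n) i)
        (i.removeNth (Matrix.vecCons (X p) v)) :=
    ContinuousAlternatingMap.alternatizeUncurryFin_apply _ _
  rw [Pi.add_apply, ContinuousAlternatingMap.add_apply, hD, Fin.sum_univ_succ]
  cases k with
  | zero =>
    simp [localD]
  | succ k =>
    have hc : HasFDerivAt (fun y => (θ y (k + 1)).curryLeft)
        ((ContinuousAlternatingMap.curryLeftLI (𝕜 := ℝ) (E := Vec n) (F := ℂ)
          (n := k)).toContinuousLinearMap.comp (fderiv ℝ (fun y => θ y (k + 1)) p)) p :=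
      (ContinuousAlternatingMap.curryLeftLI (𝕜 := ℝ) (E := Vec n) (F := ℂ)
          (n := k)).toContinuousLinearMap.hasFDerivAt.comp p (hθ.differentiableAt (k + 1)).hasFDerivAt
    have hd : fderiv ℝ (fun y => (θ y (k + 1)).curryLeft (X y)) p = _ :=
      (hc.clm_apply hX.hasFDerivAt).fderiv
    -- Moving the argument $\partial_{v_i}X$ from slot $i$ to the front produces the sign occurring
    -- in $d(\iota_X\theta)$.
    have hU : ∀ i : Fin (k + 1), θ p (k + 1) (Function.update v i (fderiv ℝ X p (v i))) =
        (-1) ^ (i : ℕ) • θ p (k + 1) (Matrix.vecCons (fderiv ℝ X p (v i)) (i.removeNth v)) := by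
      intro i
      rw [← ContinuousAlternatingMap.map_insertNth, Fin.insertNth_removeNth]
    have hR : ∀ i : Fin (k + 1), (i.succ.removeNth (Matrix.vecCons (X p) v) : Fin (k + 1) → Vec n) =
        Matrix.vecCons (X p) (i.removeNth v) := by
      intro i
      funext j
      refine Fin.cases ?_ (fun j => ?_) j <;> simp [Fin.removeNth, Matrix.vecCons]
    simp only [localD, extDeriv, contract]
    rw [hd, ContinuousAlternatingMap.alternatizeUncurryFin_apply, add_left_comm]
    congr 1
    · simp
    -- The terms $(\partial_{v_i}\theta)(X,\dots)$ of $d\iota_X\theta$ and $\iota_Xd\theta$ cancel,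
    -- leaving those that differentiate $X$.
    · rw [← Finset.sum_add_distrib]
      refine Finset.sum_congr rfl fun i _ => ?_
      rw [hU, hR]
      simp [pow_succ]

end Calculus

/-! ### Passing between the manifold and the preferred chart. -/

section Chart

open Filter Topology

variable {n : ℕ} {M : Type*} [TopologicalSpace M] [ChartedSpace (Vec n) M]

/-- A form of mixed degree in the preferred chart around `x₀`. -/
noncomputable def localMixed (θ : MixedDForm n M) (x₀ : M) (y : Vec n) : MixedForm n :=
  fun k => localRep (fun x => θ x k) x₀ y

/-- A field of covectors in the preferred chart around `x₀`. -/
noncomputable def localCovector (ξ : (x : M) → TangentSpace (𝓡 n) x →L[ℝ] ℝ) (x₀ : M) (y : Vec n) :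
    Vec n →L[ℝ] ℝ :=
  (ξ ((extChartAt (𝓡 n) x₀).symm y)).comp
    (mfderiv 𝓘(ℝ, Vec n) (𝓡 n) (extChartAt (𝓡 n) x₀).symm y)

theorem covectorWedge_comp (A : Vec n →L[ℝ] Vec n) (ξ : Vec n →L[ℝ] ℝ) (θ : MixedForm n) :
    (fun k => (covectorWedge ξ θ k).compContinuousLinearMap A : MixedForm n) =
      covectorWedge (ξ.comp A) (fun k => (θ k).compContinuousLinearMap A) := by
  funext k
  cases k with
  | zero => rfl
  | succ k =>
    ext v
    rw [covectorWedge_succ_apply, ContinuousAlternatingMap.compContinuousLinearMap_apply,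
      covectorWedge_succ_apply]
    rfl

theorem contract_comp (A : Vec n →L[ℝ] Vec n) {v w : Vec n} (h : A v = w) (θ : MixedForm n) :
    (fun k => (contract w θ k).compContinuousLinearMap A : MixedForm n) =
      contract v (fun k => (θ k).compContinuousLinearMap A) := by
  subst h
  funext k
  ext u
  change θ (k + 1) _ = θ (k + 1) _
  congr 1
  funext j
  refine Fin.cases ?_ (fun j => ?_) j <;> simp

theorem localMixed_covectorWedge (ξ : (x : M) → TangentSpace (𝓡 n) x →L[ℝ] ℝ)
    (θ : MixedDForm n M) (x₀ : M) (y : Vec n) :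
    localMixed (fun x => covectorWedge (ξ x) (θ x)) x₀ y =
      covectorWedge (localCovector ξ x₀ y) (localMixed θ x₀ y) :=
  covectorWedge_comp _ _ _

theorem localRep_ofSubsingleton (ξ : (x : M) → TangentSpace (𝓡 n) x →L[ℝ] ℝ) (x₀ : M) :
    localRep (fun x => ContinuousAlternatingMap.ofSubsingleton ℝ (TangentSpace (𝓡 n) x) ℝ
      (0 : Fin 1) (ξ x)) x₀ =
    fun y => ContinuousAlternatingMap.ofSubsingleton ℝ (Vec n) ℝ (0 : Fin 1)
      (localCovector ξ x₀ y) := by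
  funext y
  ext v
  rfl

variable [IsManifold (𝓡 n) ∞ M]

instance isManifold_one : IsManifold (𝓡 n) 1 M := .of_le (n := ∞) (by simp)

/-- The tangent space at $x$ is identified with the model space through the preferred chart at $x$,
so that chart and its inverse have identity derivative there. Local expressions at the centre
therefore equal the global objects. -/
theorem mfderiv_extChartAt_symm_self (x : M) :
    mfderiv 𝓘(ℝ, Vec n) (𝓡 n) (extChartAt (𝓡 n) x).symm (extChartAt (𝓡 n) x x) =
      ContinuousLinearMap.id ℝ (Vec n) := by
  have := mfderivWithin_range_extChartAt_symm (I := 𝓡 n) (x := x)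
  simpa using! this

theorem mfderiv_extChartAt_symm_comp {x : M} {y : Vec n} (hy : y ∈ (extChartAt (𝓡 n) x).target)
    (v : TangentSpace (𝓡 n) ((extChartAt (𝓡 n) x).symm y)) :
    mfderiv 𝓘(ℝ, Vec n) (𝓡 n) (extChartAt (𝓡 n) x).symm y
      (mfderiv (𝓡 n) 𝓘(ℝ, Vec n) (extChartAt (𝓡 n) x) ((extChartAt (𝓡 n) x).symm y) v) = v := by
  have := mfderivWithin_extChartAt_symm_comp_mfderiv_extChartAt (I := 𝓡 n) hy
  have h := DFunLike.congr_fun this v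
  simpa using! h

theorem localMixed_contract (X : (x : M) → TangentSpace (𝓡 n) x)
    (θ : MixedDForm n M) {x₀ : M} {y : Vec n} (hy : y ∈ (extChartAt (𝓡 n) x₀).target) :
    localMixed (fun x => contract (X x) (θ x)) x₀ y =
      contract (localField X x₀ y) (localMixed θ x₀ y) :=
  contract_comp _ (mfderiv_extChartAt_symm_comp hy _) _

theorem localMixed_self (θ : MixedDForm n M) (x : M) :
    localMixed θ x (extChartAt (𝓡 n) x x) = θ x := by
  funext k
  ext v
  -- The round trip through the chart returns $x$ only propositionally; viewing the form as a
  -- function on the fixed model space permits the substitution.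
  have h : ∀ z : M, z = x → (θ z k : (Fin k → Vec n) → ℂ) v = (θ x k : (Fin k → Vec n) → ℂ) v := by
    rintro z rfl; rfl
  refine Eq.trans ?_ (h _ ((extChartAt (𝓡 n) x).left_inv (mem_extChartAt_source x)))
  change (θ _ k : (Fin k → Vec n) → ℂ) _ = (θ _ k : (Fin k → Vec n) → ℂ) _
  congr 1
  funext i
  exact DFunLike.congr_fun (mfderiv_extChartAt_symm_self x) (v i)

theorem localCovector_self (ξ : (x : M) → TangentSpace (𝓡 n) x →L[ℝ] ℝ) (x : M) :
    localCovector ξ x (extChartAt (𝓡 n) x x) = ξ x := by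
  ext v
  have h : ∀ z : M, z = x → (ξ z : Vec n → ℝ) v = (ξ x : Vec n → ℝ) v := by
    rintro z rfl; rfl
  refine Eq.trans ?_ (h _ ((extChartAt (𝓡 n) x).left_inv (mem_extChartAt_source x)))
  change (ξ _ : Vec n → ℝ) _ = (ξ _ : Vec n → ℝ) _
  congr 1
  exact DFunLike.congr_fun (mfderiv_extChartAt_symm_self x) v

theorem mfderiv_extChartAt_eq_id (x : M) : (mfderiv (𝓡 n) 𝓘(ℝ, Vec n) (extChartAt (𝓡 n) x) x :
      Vec n →L[ℝ] Vec n) = ContinuousLinearMap.id ℝ (Vec n) :=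
  mfderiv_extChartAt_self

theorem localField_self (X : (x : M) → TangentSpace (𝓡 n) x) (x : M) :
    localField X x (extChartAt (𝓡 n) x x) = X x := by
  have h : ∀ z : M, z = x → (mfderiv (𝓡 n) 𝓘(ℝ, Vec n) (extChartAt (𝓡 n) x) z (X z) : Vec n) =
      mfderiv (𝓡 n) 𝓘(ℝ, Vec n) (extChartAt (𝓡 n) x) x (X x) := by
    rintro z rfl; rfl
  refine (h _ ((extChartAt (𝓡 n) x).left_inv (mem_extChartAt_source x))).trans ?_
  exact DFunLike.congr_fun (mfderiv_extChartAt_eq_id x) (X x)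

theorem extD_eq {W : Type*} [NormedAddCommGroup W] [NormedSpace ℝ W] {k : ℕ} (θ : DForm n M W k)
    (x : M) : extD θ x = extDeriv (localRep θ x) (extChartAt (𝓡 n) x x) := by
  ext v
  change extDeriv (localRep θ x) (extChartAt (𝓡 n) x x) _ = _
  congr 1
  funext i
  exact DFunLike.congr_fun (mfderiv_extChartAt_eq_id x) (v i)

theorem extDMixed_eq (θ : MixedDForm n M) (x : M) :
    extDMixed θ x = localD (localMixed θ x) (extChartAt (𝓡 n) x x) := by
  funext k
  cases k with
  | zero => rfl
  | succ k => exact extD_eq _ x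

theorem lieDMixed_eq (X : (x : M) → TangentSpace (𝓡 n) x) (θ : MixedDForm n M) (x : M) :
    lieDMixed X θ x = fun k => localLieD (localField X x) (fun y => localMixed θ x y k)
      (extChartAt (𝓡 n) x x) := by
  funext k
  ext v
  change localLieD (localField X x) (fun y => localMixed θ x y k) (extChartAt (𝓡 n) x x) _ = _
  congr 1
  funext i
  exact DFunLike.congr_fun (mfderiv_extChartAt_eq_id x) (v i)

omit [IsManifold (𝓡 n) ∞ M] in
theorem IsSmoothMixed.localMixed {θ : MixedDForm n M} (h : IsSmoothMixed θ) (x : M) :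
    SmoothMixedAt (localMixed θ x) (extChartAt (𝓡 n) x x) := fun k =>
  (h k x).contDiffAt (extChartAt_target_mem_nhds x)

theorem contDiffAt_comp_extChartAt_symm {W : Type*} [NormedAddCommGroup W] [NormedSpace ℝ W]
    {g : M → W} {x : M} (hg : ContMDiffAt (𝓡 n) 𝓘(ℝ, W) ∞ g x) :
    ContDiffAt ℝ ∞ (fun y => g ((extChartAt (𝓡 n) x).symm y)) (extChartAt (𝓡 n) x x) := by
  have h : ContMDiffAt 𝓘(ℝ, Vec n) (𝓡 n) ∞ (extChartAt (𝓡 n) x).symm (extChartAt (𝓡 n) x x) :=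
    (contMDiffOn_extChartAt_symm x).contMDiffAt (extChartAt_target_mem_nhds x)
  exact (hg.comp_of_eq h ((extChartAt (𝓡 n) x).left_inv (mem_extChartAt_source x))).contDiffAt

theorem IsSmoothMixed.smul {c : M → ℂ} (hc : ContMDiff (𝓡 n) 𝓘(ℝ, ℂ) ∞ c) {θ : MixedDForm n M}
    (h : IsSmoothMixed θ) : IsSmoothMixed (fun x => c x • θ x) := fun k x => by
  refine ContDiffOn.smul (f := fun y => c ((extChartAt (𝓡 n) x).symm y)) ?_ (h k x)
  have := hc.comp_contMDiffOn (contMDiffOn_extChartAt_symm (I := 𝓡 n) (n := ∞) x)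
  exact contMDiffOn_iff_contDiffOn.1 this

theorem localCovector_mfderiv {g : M → ℝ} (hg : ContMDiff (𝓡 n) 𝓘(ℝ, ℝ) ∞ g) {x : M} {y : Vec n}
    (hy : y ∈ (extChartAt (𝓡 n) x).target) :
    localCovector (fun z => mfderiv (𝓡 n) 𝓘(ℝ, ℝ) g z) x y =
      fderiv ℝ (fun y => g ((extChartAt (𝓡 n) x).symm y)) y := by
  have h₁ : MDifferentiableAt 𝓘(ℝ, Vec n) (𝓡 n) (extChartAt (𝓡 n) x).symm y := by
    rw [← mdifferentiableWithinAt_univ]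
    simpa using mdifferentiableWithinAt_extChartAt_symm (I := 𝓡 n) hy
  have h₂ := mfderiv_comp y (hg.mdifferentiable (by simp) _) h₁
  rw [← mfderiv_eq_fderiv]
  exact h₂.symm

theorem fderiv_comp_extChartAt_symm {g : M → ℝ} (hg : ContMDiff (𝓡 n) 𝓘(ℝ, ℝ) ∞ g) (x : M) :
    fderiv ℝ (fun y => g ((extChartAt (𝓡 n) x).symm y)) (extChartAt (𝓡 n) x x) =
      mfderiv (𝓡 n) 𝓘(ℝ, ℝ) g x := by
  rw [← localCovector_mfderiv hg (mem_extChartAt_target x)]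
  exact localCovector_self _ x

/-- On the chart domain the preferred trivialization of the tangent bundle is the derivative of the
chart, so the local field is the fibre coordinate of the section. -/
theorem contDiffAt_localField {X : (x : M) → TangentSpace (𝓡 n) x} {x : M}
    (hX : ContMDiffAt (𝓡 n) ((𝓡 n).prod 𝓘(ℝ, Vec n)) ∞ (fun z => TotalSpace.mk' (Vec n) z (X z)) x) :
    ContDiffAt ℝ ∞ (localField X x) (extChartAt (𝓡 n) x x) := by
  have h := (contMDiffAt_section (IB := 𝓡 n) (F := Vec n) x).1 hX
  refine (contDiffAt_comp_extChartAt_symm h).congr_of_eventuallyEq ?_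
  filter_upwards [extChartAt_target_mem_nhds (I := 𝓡 n) x] with y hy
  have hy' : (extChartAt (𝓡 n) x).symm y ∈ (chartAt (Vec n) x).source := by
    simpa using (extChartAt (𝓡 n) x).map_target hy
  have h3 := TangentBundle.continuousLinearMapAt_trivializationAt (I := 𝓡 n) hy'
  have h4 := (trivializationAt (Vec n) (TangentSpace (𝓡 n)) x).coe_linearMapAt_of_mem (R := ℝ)
    (b := (extChartAt (𝓡 n) x).symm y) (by simpa using hy')
  exact (DFunLike.congr_fun h3 _).symm.trans (congrFun h4 (X _))

/-- It suffices to test $\xi$ on the coordinate vector fields of the chart, whose values are the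
components of the local covector. -/
theorem contDiffAt_localCovector {ξ : (x : M) → TangentSpace (𝓡 n) x →L[ℝ] ℝ} {x : M}
    (hξ : ∀ V : (x : M) → TangentSpace (𝓡 n) x,
      ContMDiffAt (𝓡 n) ((𝓡 n).prod 𝓘(ℝ, Vec n)) ∞ (fun z => TotalSpace.mk' (Vec n) z (V z)) x →
        ContMDiffAt (𝓡 n) 𝓘(ℝ, ℝ) ∞ (fun z => ξ z (V z)) x) :
    ContDiffAt ℝ ∞ (localCovector ξ x) (extChartAt (𝓡 n) x x) := by
  have hexp : localCovector ξ x = fun y => ∑ i : Fin n,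
      localCovector ξ x y (EuclideanSpace.single i (1 : ℝ)) • EuclideanSpace.proj i := by
    funext y
    ext v
    conv_lhs => rw [← sum_smul_single v, map_sum]
    simp [mul_comm]
  rw [hexp]
  refine ContDiffAt.sum fun i _ => ?_
  suffices h : ContDiffAt ℝ ∞ (fun y => localCovector ξ x y (EuclideanSpace.single i (1 : ℝ)))
      (extChartAt (𝓡 n) x x) from
    h.smul (contDiffAt_const (c := (EuclideanSpace.proj i : Vec n →L[ℝ] ℝ)))
  let e := trivializationAt (Vec n) (TangentSpace (𝓡 n) : M → Type) x
  have hx : x ∈ e.baseSet := mem_baseSet_trivializationAt _ _ x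
  have hs := e.contMDiffAt_symmL (IB := 𝓡 n) (n := ∞) (𝕜 := ℝ) hx
  have hV : ContMDiffAt (𝓡 n) ((𝓡 n).prod 𝓘(ℝ, Vec n)) ∞ (fun z => TotalSpace.mk' (Vec n) z
      (e.symmL ℝ z (EuclideanSpace.single i (1 : ℝ)))) x :=
    hs.clm_bundle_apply (contMDiffAt_section (IB := 𝓡 n) (F := Vec n) x |>.2 (by
      simpa using contMDiffAt_const))
  refine (contDiffAt_comp_extChartAt_symm (hξ _ hV)).congr_of_eventuallyEq ?_
  filter_upwards [extChartAt_target_mem_nhds (I := 𝓡 n) x] with y hy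
  have hy' : (extChartAt (𝓡 n) x).symm y ∈ (chartAt (Vec n) x).source := by
    simpa using (extChartAt (𝓡 n) x).map_target hy
  have h3 := TangentBundle.symmL_trivializationAt (I := 𝓡 n) hy'
  rw [(extChartAt (𝓡 n) x).right_inv hy] at h3
  have h4 : mfderivWithin 𝓘(ℝ, Vec n) (𝓡 n) (extChartAt (𝓡 n) x).symm (Set.range (𝓡 n)) y =
      mfderiv 𝓘(ℝ, Vec n) (𝓡 n) (extChartAt (𝓡 n) x).symm y := by
    rw [modelWithCornersSelf_coe, Set.range_id, mfderivWithin_univ]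
  rw [h4] at h3
  change ξ _ _ = ξ _ _
  congr 1
  exact (DFunLike.congr_fun h3 _).symm

end Chart

/-! ### Leibniz rules and the coefficients of the exponential. -/

section Calculus

open Filter Topology

variable {n : ℕ} {θ : Vec n → MixedForm n} {p : Vec n}

theorem SmoothMixedAt.contract {X : Vec n → Vec n} (hX : ContDiffAt ℝ ∞ X p)
    (h : SmoothMixedAt θ p) : SmoothMixedAt (fun y => contract (X y) (θ y)) p := fun k =>
  ContDiffAt.clm_apply ((ContinuousAlternatingMap.curryLeftLI (𝕜 := ℝ) (E := Vec n) (F := ℂ)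
    (n := k)).contDiff.contDiffAt.comp p (h (k + 1))) hX

theorem localD_const_smul (c : ℂ) (hθ : SmoothMixedAt θ p) :
    localD (fun y => c • θ y) p = c • localD θ p := by
  simpa using localD_smul (κ := Empty) (f := fun _ => c) (c := fun _ => 0) (ξ := fun _ => 0)
    (by simpa using hasFDerivAt_const c p) hθ

/-- The part of the Lie derivative involving $\partial X$ is pointwise linear in the form, so only
$\partial_X\theta$ produces the extra term $(Xf)\theta$. -/
theorem localLieD_smul {κ : Type*} [Fintype κ] {f : Vec n → ℂ} {c : κ → ℂ}
    {ξ : κ → Vec n →L[ℝ] ℝ} (hf : HasFDerivAt f (∑ j, c j • Complex.ofRealCLM.comp (ξ j)) p)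
    (hθ : SmoothMixedAt θ p) (X : Vec n → Vec n) :
    (fun k => localLieD X (fun y => f y • θ y k) p : MixedForm n) =
      (∑ j, c j * (ξ j (X p) : ℂ)) • θ p + f p • fun k => localLieD X (fun y => θ y k) p := by
  funext k
  ext v
  have h : fderiv ℝ (fun y => f y • θ y k) p = _ :=
    (hf.smul (hθ.differentiableAt k).hasFDerivAt).fderiv
  rw [Pi.add_apply, ContinuousAlternatingMap.add_apply, Pi.smul_apply, Pi.smul_apply,
    ContinuousAlternatingMap.smul_apply, ContinuousAlternatingMap.smul_apply, localLieD_apply,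
    localLieD_apply, h]
  simp only [add_apply, smul_apply, ContinuousLinearMap.smulRight_apply,
    ContinuousAlternatingMap.add_apply, ContinuousAlternatingMap.smul_apply, sum_apply,
    ContinuousLinearMap.comp_apply, smul_eq_mul, Complex.ofRealCLM_apply, ← Finset.mul_sum]
  ring

/-- The coefficient of `u^m` in `exp (∑ j, u_j t_j)`. -/
noncomputable def expCoeff {ι : Type*} [Fintype ι] (t : ι → ℂ) (m : ι →₀ ℕ) : ℂ :=
  ∏ j, t j ^ m j / ((m j).factorial : ℂ)

theorem hasDerivAt_pow_div_factorial (a t : ℂ) (k : ℕ) :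
    HasDerivAt (fun t => (a * t) ^ k / (k.factorial : ℂ))
      (if k = 0 then 0 else a * ((a * t) ^ (k - 1) / ((k - 1).factorial : ℂ))) t := by
  have h := (((hasDerivAt_id t).const_mul a).pow k).div_const (k.factorial : ℂ)
  refine h.congr_deriv ?_
  cases k with
  | zero => simp
  | succ k =>
    have : (k.factorial : ℂ) ≠ 0 := by exact_mod_cast k.factorial_ne_zero
    have : (k + 1 : ℂ) ≠ 0 := by exact_mod_cast k.succ_ne_zero
    simp [Nat.factorial_succ]
    field_simp

/-- Coefficientwise form of the derivative of an exponential: a divided power differentiates to the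
preceding one, lowering $m$ by one at $j$. The guard `m j = 0` is needed because the subtraction is
truncated. -/
theorem hasFDerivAt_expCoeff {ι : Type*} [Fintype ι] (a : ℂ) {u : ι → Vec n → ℝ}
    {ξ : ι → Vec n →L[ℝ] ℝ} (hu : ∀ j, HasFDerivAt (u j) (ξ j) p) (m : ι →₀ ℕ) :
    HasFDerivAt (fun y => expCoeff (fun j => a * (u j y : ℂ)) m)
      (∑ j, (if m j = 0 then 0 else
        a * expCoeff (fun j => a * (u j p : ℂ)) (m - Finsupp.single j 1)) •
          Complex.ofRealCLM.comp (ξ j)) p := by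
  classical
  have h : ∀ j, HasFDerivAt (fun y => (a * (u j y : ℂ)) ^ m j / ((m j).factorial : ℂ))
      ((if m j = 0 then 0 else a * ((a * (u j p : ℂ)) ^ (m j - 1) /
        ((m j - 1).factorial : ℂ))) • Complex.ofRealCLM.comp (ξ j)) p := fun j =>
    (hasDerivAt_pow_div_factorial a (u j p) (m j)).comp_hasFDerivAt
      (f := fun y => (u j y : ℂ)) p (Complex.ofRealCLM.hasFDerivAt.comp p (hu j))
  refine (HasFDerivAt.finsetProd (u := Finset.univ) fun j _ => h j).congr_fderiv ?_
  refine Finset.sum_congr rfl fun j _ => ?_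
  rw [smul_smul]
  congr 1
  split_ifs with hj
  · simp
  · rw [expCoeff, ← Finset.mul_prod_erase _ _ (Finset.mem_univ j)]
    have : ∀ i ∈ Finset.univ.erase j, (a * (u i p : ℂ)) ^ (m - Finsupp.single j 1 : ι →₀ ℕ) i /
        (((m - Finsupp.single j 1 : ι →₀ ℕ) i).factorial : ℂ) =
        (a * (u i p : ℂ)) ^ m i / ((m i).factorial : ℂ) := fun i hi => by
      simp [(Finset.ne_of_mem_erase hi).symm]
    rw [Finset.prod_congr rfl this]
    simp
    ring

end Calculus

/-! ### Fibrewise algebra of the extended complex structure. -/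

section Courant

open Filter Topology

variable {n : ℕ} {M : Type*} [TopologicalSpace M] [ChartedSpace (Vec n) M] [IsManifold (𝓡 n) ∞ M]
  {F : Type*} [NormedAddCommGroup F] [NormedSpace ℝ F]
  {E : M → Type*} [TopologicalSpace (TotalSpace F E)] [∀ x, TopologicalSpace (E x)]
  [∀ x, AddCommGroup (E x)] [∀ x, Module ℝ (E x)] [∀ x, IsTopologicalAddGroup (E x)]
  [∀ x, ContinuousSMul ℝ (E x)] [FiberBundle F E] [VectorBundle ℝ F E]
  {C : ExtendedTangentBundle n M F E}

theorem ExtendedTangentBundle.anchor_coanchor (C : ExtendedTangentBundle n M F E) (x : M)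
    (ξ : TangentSpace (𝓡 n) x →L[ℝ] ℝ) : C.anchor x (C.coanchor x ξ) = 0 :=
  (C.exact x _).2 ⟨ξ, rfl⟩

theorem ExtendedTangentBundle.pairing_coanchor_coanchor (C : ExtendedTangentBundle n M F E) (x : M)
    (ξ η : TangentSpace (𝓡 n) x →L[ℝ] ℝ) : C.pairing x (C.coanchor x ξ) (C.coanchor x η) = 0 := by
  have := C.pairing_coanchor x ξ (C.coanchor x η)
  rw [C.anchor_coanchor, map_zero] at this
  linarith

/-- Orthogonality and $\mathcal J^2=-1$ make $\mathcal J$ skew for the pairing, and evaluating a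
covector on the anchor is twice the pairing. -/
theorem ExtendedComplexStructure.poisson_antisymm (J : ExtendedComplexStructure C) (x : M)
    (ξ η : TangentSpace (𝓡 n) x →L[ℝ] ℝ) : ξ (J.poisson x η) = -η (J.poisson x ξ) := by
  rw [poisson, poisson, ← C.pairing_coanchor, ← C.pairing_coanchor,
    ← J.orthogonal x (C.coanchor x ξ), J.sq, map_neg, C.pairing_symm x _ (C.coanchor x η)]
  ring

theorem IsotropicSplitting.covectorPart_coanchor (s : IsotropicSplitting C) (x : M)
    (ξ : TangentSpace (𝓡 n) x →L[ℝ] ℝ) : s.covectorPart x (C.coanchor x ξ) = ξ := by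
  apply C.coanchor_injective x
  rw [s.coanchor_covectorPart, C.anchor_coanchor, map_zero, sub_zero]

theorem IsotropicSplitting.cliffordHom_coanchor (s : IsotropicSplitting C) (x : M)
    (ξ : TangentSpace (𝓡 n) x →L[ℝ] ℝ) (θ : MixedForm n) :
    s.cliffordHom x (C.coanchor x ξ) θ = covectorWedge ξ θ := by
  change clifford (C.anchor x (C.coanchor x ξ)) (s.covectorPart x (C.coanchor x ξ)) θ = _
  rw [C.anchor_coanchor, s.covectorPart_coanchor]
  unfold clifford
  have := contract_smul_left 0 (0 : Vec n) θ
  rw [zero_smul, zero_smul] at this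
  rw [show contract (0 : TangentSpace (𝓡 n) x) θ = 0 from this, zero_add]

/-- Up to a factor $\frac12$, $1-i\mathcal J$ is the projection onto $L$. -/
theorem ExtendedComplexStructure.sub_mem_iEigenspace (J : ExtendedComplexStructure C) (x : M)
    (v : E x) : (1 : ℂ) ⊗ₜ[ℝ] v + (-Complex.I) ⊗ₜ[ℝ] J.J x v ∈ iEigenspace (J.J x) := by
  rw [iEigenspace, Module.End.mem_eigenspace_iff]
  rw [map_add, LinearMap.baseChange_tmul, LinearMap.baseChange_tmul, ContinuousLinearMap.coe_coe,
    J.sq, smul_add, TensorProduct.smul_tmul', TensorProduct.smul_tmul', smul_eq_mul, smul_eq_mul,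
    TensorProduct.tmul_neg, TensorProduct.neg_tmul, neg_neg, mul_one, mul_neg, Complex.I_mul_I,
    neg_neg, add_comm]

/-- The identity behind the whole theorem: $a^*\xi-i\mathcal Ja^*\xi\in L$ annihilates the spinor,
and $a^*\xi$ acts by exterior multiplication. -/
theorem IsotropicSplitting.cliffordHom_J_coanchor (s : IsotropicSplitting C)
    (J : ExtendedComplexStructure C) (x : M) (ξ : TangentSpace (𝓡 n) x →L[ℝ] ℝ) {θ : MixedForm n}
    (hθ : ∀ v ∈ iEigenspace (J.J x), s.cliffordComplex x v θ = 0) :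
    s.cliffordHom x (J.J x (C.coanchor x ξ)) θ = -Complex.I • covectorWedge ξ θ := by
  have h := hθ _ (J.sub_mem_iEigenspace x (C.coanchor x ξ))
  rw [IsotropicSplitting.cliffordComplex, map_add, LinearMap.liftBaseChange_tmul,
    LinearMap.liftBaseChange_tmul, one_smul, LinearMap.add_apply, LinearMap.smul_apply,
    s.cliffordHom_coanchor] at h
  have h' : covectorWedge ξ θ =
      Complex.I • s.cliffordHom x (J.J x (C.coanchor x ξ)) θ := by
    rw [neg_smul] at h
    exact eq_of_sub_eq_zero (by rw [sub_eq_add_neg]; exact h)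
  rw [h', smul_smul, neg_mul, Complex.I_mul_I, neg_neg, one_smul]

end Courant

/-! ### The twisted differential and Lie derivative on spinors. -/

section Courant

open Filter Topology

variable {n : ℕ} {M : Type*} [TopologicalSpace M] [ChartedSpace (Vec n) M] [IsManifold (𝓡 n) ∞ M]
  {F : Type*} [NormedAddCommGroup F] [NormedSpace ℝ F]
  {E : M → Type*} [TopologicalSpace (TotalSpace F E)] [∀ x, TopologicalSpace (E x)]
  [∀ x, AddCommGroup (E x)] [∀ x, Module ℝ (E x)] [∀ x, IsTopologicalAddGroup (E x)]
  [∀ x, ContinuousSMul ℝ (E x)] [FiberBundle F E] [VectorBundle ℝ F E]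
  {C : ExtendedTangentBundle n M F E}

theorem contDiffAt_localField_anchor (C : ExtendedTangentBundle n M F E) (X : Cₛ^∞⟮𝓡 n; F, E⟯)
    (x : M) :
    ContDiffAt ℝ ∞ (localField (fun z => C.anchor z (X z)) x) (extChartAt (𝓡 n) x x) :=
  contDiffAt_localField ((C.anchor_smooth x).clm_bundle_apply (X.contMDiff x))

theorem IsotropicSplitting.contDiffAt_localCovector_covectorPart [ContMDiffVectorBundle ∞ F E (𝓡 n)]
    (s : IsotropicSplitting C) (X : Cₛ^∞⟮𝓡 n; F, E⟯) (x : M) :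
    ContDiffAt ℝ ∞ (localCovector (fun z => s.covectorPart z (X z)) x) (extChartAt (𝓡 n) x x) := by
  refine contDiffAt_localCovector fun V hV => ?_
  have h₁ := (s.smooth x).clm_bundle_apply hV
  have h₂ := (s.smooth x).clm_bundle_apply ((C.anchor_smooth x).clm_bundle_apply (X.contMDiff x))
  have h₃ := (C.pairing_smooth x).clm_bundle_apply₂ ((X.contMDiff x).sub_section h₂) h₁
  have h₄ := (contMDiffAt_section (IB := 𝓡 n) (F := ℝ) (E := Bundle.Trivial M ℝ) x).1 h₃
  exact contMDiffAt_const.mul h₄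

variable [T2Space M] [SigmaCompactSpace M] {s : IsotropicSplitting C} {ρ : MixedDForm n M}

/-- The value at `x` of a form of mixed degree. -/
def formAt (θ : MixedDForm n M) (x : M) : MixedForm n := θ x

/-- Exterior multiplication by $d\xi-\iota_XH$ is linear over functions, so the derivative of $f$
comes from the ordinary Lie derivative alone. -/
theorem IsotropicSplitting.lieT_smul (s : IsotropicSplitting C) (X : Cₛ^∞⟮𝓡 n; F, E⟯)
    (hρ : IsSmoothMixed ρ) (f : M → ℂ) {κ : Type*} [Fintype κ] {c : κ → ℂ}
    (x : M) {ξ : κ → Vec n →L[ℝ] ℝ}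
    (hf : HasFDerivAt (fun y => f ((extChartAt (𝓡 n) x).symm y))
      (∑ j, c j • Complex.ofRealCLM.comp (ξ j)) (extChartAt (𝓡 n) x x)) :
    formAt (s.lieT X (fun x => f x • ρ x)) x =
      (∑ j, c j * (ξ j (C.anchor x (X x)) : ℂ)) • formAt ρ x + f x • formAt (s.lieT X ρ) x := by
  have h := localLieD_smul hf (hρ.localMixed x) (localField (fun z => C.anchor z (X z)) x)
  have h₀ : (extChartAt (𝓡 n) x).symm (extChartAt (𝓡 n) x x) = x :=
    (extChartAt (𝓡 n) x).left_inv (mem_extChartAt_source x)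
  rw [localMixed_self, localField_self, h₀] at h
  have h' : formAt (lieDMixed (fun z => C.anchor z (X z)) (fun x => f x • ρ x)) x =
      (∑ j, c j * (ξ j (C.anchor x (X x)) : ℂ)) • formAt ρ x +
        f x • formAt (lieDMixed (fun z => C.anchor z (X z)) ρ) x :=
    (lieDMixed_eq _ _ x).trans (h.trans
      (congrArg (fun η => (∑ j, c j * (ξ j (C.anchor x (X x)) : ℂ)) • formAt ρ x + f x • η)
        (lieDMixed_eq _ ρ x).symm))
  change formAt (lieDMixed (fun z => C.anchor z (X z)) (fun x => f x • ρ x)) x +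
    wedge ((extD (s.oneForm X) - s.twistingContract X) x) (f x • formAt ρ x) =
    (∑ j, c j * (ξ j (C.anchor x (X x)) : ℂ)) • formAt ρ x + f x •
      (formAt (lieDMixed (fun z => C.anchor z (X z)) ρ) x +
        wedge ((extD (s.oneForm X) - s.twistingContract X) x) (formAt ρ x))
  have hw := wedge_smul_right (f x) ((extD (s.oneForm X) - s.twistingContract X) x) (formAt ρ x)
  rw [h', smul_add, ← add_assoc]
  exact congrArg _ hw

theorem IsotropicSplitting.dT_smul (s : IsotropicSplitting C)
    (hρ : IsSmoothMixed ρ) (f : M → ℂ) {κ : Type*} [Fintype κ] {c : κ → ℂ}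
    (x : M) {ξ : κ → Vec n →L[ℝ] ℝ}
    (hf : HasFDerivAt (fun y => f ((extChartAt (𝓡 n) x).symm y))
      (∑ j, c j • Complex.ofRealCLM.comp (ξ j)) (extChartAt (𝓡 n) x x)) :
    formAt (s.dT (fun x => f x • ρ x)) x =
      ∑ j, c j • covectorWedge (ξ j) (formAt ρ x) + f x • formAt (s.dT ρ) x := by
  have h := localD_smul hf (hρ.localMixed x)
  have h₀ : (extChartAt (𝓡 n) x).symm (extChartAt (𝓡 n) x x) = x :=
    (extChartAt (𝓡 n) x).left_inv (mem_extChartAt_source x)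
  rw [localMixed_self, h₀] at h
  have h' : formAt (extDMixed (fun x => f x • ρ x)) x =
      ∑ j, c j • covectorWedge (ξ j) (formAt ρ x) + f x • formAt (extDMixed ρ) x :=
    (extDMixed_eq _ x).trans (h.trans
      (congrArg (fun η => ∑ j, c j • covectorWedge (ξ j) (formAt ρ x) + f x • η)
        (extDMixed_eq ρ x).symm))
  change formAt (extDMixed (fun x => f x • ρ x)) x - wedge (s.twisting x) (f x • formAt ρ x) =
    ∑ j, c j • covectorWedge (ξ j) (formAt ρ x) +
      f x • (formAt (extDMixed ρ) x - wedge (s.twisting x) (formAt ρ x))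
  have hw := wedge_smul_right (f x) (s.twisting x) (formAt ρ x)
  rw [h', smul_sub, ← add_sub_assoc]
  exact congrArg _ hw

/-- On `ℝⁿ`: if `dθ = T ∧ θ` and `ι_v θ + ξ ∧ θ = c dγ ∧ θ`, then
`L_v θ + (dξ - ι_v T) ∧ θ = 0`. -/
theorem localLieD_add_wedge_eq_zero {θ : Vec n → MixedForm n} {p : Vec n} {v : Vec n → Vec n}
    {ξ : Vec n → Vec n →L[ℝ] ℝ} {γ : Vec n → ℝ} {T : Vec n [⋀^Fin 3]→L[ℝ] ℝ} {c : ℂ}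
    (hθ : SmoothMixedAt θ p) (hv : ContDiffAt ℝ ∞ v p) (hξ : ContDiffAt ℝ ∞ ξ p)
    (hγ : ContDiffAt ℝ ∞ γ p) (hd : localD θ p = wedge T (θ p))
    (hloc : ∀ᶠ y in 𝓝 p, clifford (v y) (ξ y) (θ y) = c • covectorWedge (fderiv ℝ γ y) (θ y)) :
    (fun k => localLieD v (fun y => θ y k) p : MixedForm n) +
      wedge (extDeriv (fun y => ContinuousAlternatingMap.ofSubsingleton ℝ (Vec n) ℝ (0 : Fin 1)
        (ξ y)) p - T.curryLeft (v p)) (θ p) = 0 := by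
  -- Differentiate `hloc`: $d(\iota_v\theta+\xi\wedge\theta)=-c\,d\gamma\wedge d\theta$. Only
  -- $\theta$ and $\gamma$ are differentiated on the right, so $d\theta=T\wedge\theta$ is needed at
  -- $p$ alone and no derivative of the twisting form appears.
  have hι : localD (fun y => contract (v y) (θ y)) p + localD (fun y => covectorWedge (ξ y) (θ y)) p =
      -(c • covectorWedge (fderiv ℝ γ p) (localD θ p)) := by
    rw [← localD_add (.contract hv hθ) (.covectorWedge hξ hθ), ← smul_neg,
      ← localD_fderiv_wedge hγ hθ, ← localD_const_smul c
        (.covectorWedge (hγ.fderiv_right (by simp)) hθ)]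
    exact localD_congr fun k => hloc.mono fun y hy => congrFun hy k
  have hcl := clifford_wedge_three (v p) (ξ p) T (θ p)
  rw [hloc.self_of_nhds, wedge_smul_right] at hcl
  have hanti := covectorWedge_wedge (fderiv ℝ γ p) T (θ p)
  rw [wedge_sub_left, sub_eq_iff_eq_add.1 (localD_covectorWedge hξ hθ).symm,
    localLieD_eq (hv.differentiableAt (by simp)) hθ]
  have hA : c • covectorWedge (fderiv ℝ γ p) (wedge T (θ p)) =
      -(c • wedge T (covectorWedge (fderiv ℝ γ p) (θ p))) := by
    rw [hanti, ← smul_neg]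
    congr 1
    norm_num
  rw [hd, hA, neg_neg] at hι
  rw [hd]
  rw [clifford] at hcl
  -- Here $t=c\,T\wedge d\gamma\wedge\theta$ and $w=\iota_vT\wedge\theta$: $d$ of the Clifford
  -- product gives $t$, the Clifford product with $d\theta$ gives $w-t$, and the twist removes $w$.
  have hab : ∀ a₁ a₂ b₁ b₂ w t : MixedForm n, a₁ + a₂ = t → b₁ + b₂ = w - t →
      a₁ + b₁ + (a₂ + b₂ - w) = 0 := fun a₁ a₂ b₁ b₂ w t h₁ h₂ => by
    rw [show a₁ + b₁ + (a₂ + b₂ - w) = (a₁ + a₂) + (b₁ + b₂) - w by abel, h₁, h₂]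
    abel
  exact hab _ _ _ _ _ _ hι hcl

/-- A closed spinor `ρ` with `ι_𝔛 ρ = c dg ∧ ρ` is invariant under `𝔛`. -/
theorem IsotropicSplitting.lieT_eq_zero [ContMDiffVectorBundle ∞ F E (𝓡 n)]
    (s : IsotropicSplitting C) (X : Cₛ^∞⟮𝓡 n; F, E⟯) (hρ : IsSmoothMixed ρ) (hd : s.dT ρ = 0)
    {g : M → ℝ} (hg : ContMDiff (𝓡 n) 𝓘(ℝ, ℝ) ∞ g) (c : ℂ)
    (hX : ∀ x, s.cliffordHom x (X x) (ρ x) =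
      c • covectorWedge (mfderiv (𝓡 n) 𝓘(ℝ, ℝ) g x) (ρ x)) :
    s.lieT X ρ = 0 := by
  funext x
  have hloc : ∀ᶠ y in 𝓝 (extChartAt (𝓡 n) x x),
      clifford (localField (fun z => C.anchor z (X z)) x y)
        (localCovector (fun z => s.covectorPart z (X z)) x y) (localMixed ρ x y) =
      c • covectorWedge (fderiv ℝ (fun y => g ((extChartAt (𝓡 n) x).symm y)) y)
        (localMixed ρ x y) := by
    filter_upwards [extChartAt_target_mem_nhds (I := 𝓡 n) x] with y hy
    have h₁ := localMixed_contract (fun z => C.anchor z (X z)) ρ hy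
    have h₂ := localMixed_covectorWedge (fun z => s.covectorPart z (X z)) ρ x y
    have h₃ := localMixed_covectorWedge (fun z => mfderiv (𝓡 n) 𝓘(ℝ, ℝ) g z) ρ x y
    rw [localCovector_mfderiv hg hy] at h₃
    rw [clifford, ← h₁, ← h₂, ← h₃]
    exact congrArg (fun η => localMixed η x y) (funext hX)
  have hd' : localD (localMixed ρ x) (extChartAt (𝓡 n) x x) =
      wedge (s.twisting x) (localMixed ρ x (extChartAt (𝓡 n) x x)) := by
    rw [localMixed_self, ← extDMixed_eq ρ x]
    exact eq_of_sub_eq_zero (congrFun hd x)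
  have key := localLieD_add_wedge_eq_zero (hρ.localMixed x) (contDiffAt_localField_anchor C X x)
    (s.contDiffAt_localCovector_covectorPart X x) (contDiffAt_comp_extChartAt_symm (hg x)) hd' hloc
  rw [localMixed_self, localField_self, ← localRep_ofSubsingleton] at key
  refine Eq.trans ?_ key
  have h₁ := lieDMixed_eq (fun z => C.anchor z (X z)) ρ x
  have h₂ := extD_eq (s.oneForm X) x
  change (formAt (lieDMixed (fun z => C.anchor z (X z)) ρ) x +
    wedge (extD (s.oneForm X) x - s.twistingContract X x) (formAt ρ x) : MixedForm n) = _
  exact congrArg₂ (fun η α => (η + wedge (α - s.twistingContract X x) (formAt ρ x) : MixedForm n))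
    h₁ h₂

end Courant

/-! ### Power series in the variables $u_j$. -/

section Equivariant

variable {n : ℕ} {M : Type*} [TopologicalSpace M] [ChartedSpace (Vec n) M] [IsManifold (𝓡 n) ∞ M]
  {ι : Type*} [Fintype ι] {𝔤 : Type*} [AddCommGroup 𝔤] [Module ℝ 𝔤]

/-- The coefficient of `u^m` in `e^{-iμ}`. -/
noncomputable def momentCoeff (b : Module.Basis ι ℝ 𝔤) (μ : M → Module.Dual ℝ 𝔤) (m : ι →₀ ℕ)
    (x : M) : ℂ :=
  expCoeff (fun j => -Complex.I * (μ x (b j) : ℂ)) m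

omit [IsManifold (𝓡 n) ∞ M] in
theorem contMDiff_momentCoeff (b : Module.Basis ι ℝ 𝔤) {μ : M → Module.Dual ℝ 𝔤}
    (hμ : ∀ τ, ContMDiff (𝓡 n) 𝓘(ℝ, ℝ) ∞ (fun x => μ x τ)) (m : ι →₀ ℕ) :
    ContMDiff (𝓡 n) 𝓘(ℝ, ℂ) ∞ (momentCoeff (M := M) b μ m) := by
  have h : ContDiff ℝ ∞ fun t : ι → ℝ => expCoeff (fun j => -Complex.I * (t j : ℂ)) m :=
    contDiff_prod fun j _ => ((contDiff_const.mul
      (Complex.ofRealCLM.contDiff.comp (contDiff_apply ℝ ℝ j))).pow _).div_const _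
  exact h.contMDiff.comp (contMDiff_pi_space.2 fun j => hμ (b j))

/-- The differential of a component of the moment map. -/
noncomputable def momentDiff (μ : M → Module.Dual ℝ 𝔤) (τ : 𝔤) (x : M) : Vec n →L[ℝ] ℝ :=
  mfderiv (𝓡 n) 𝓘(ℝ, ℝ) (fun y => μ y τ) x

theorem hasFDerivAt_momentCoeff (b : Module.Basis ι ℝ 𝔤) {μ : M → Module.Dual ℝ 𝔤}
    (hμ : ∀ τ, ContMDiff (𝓡 n) 𝓘(ℝ, ℝ) ∞ (fun x => μ x τ)) (m : ι →₀ ℕ) (x : M) :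
    HasFDerivAt (fun y => momentCoeff b μ m ((extChartAt (𝓡 n) x).symm y))
      (∑ j, (if m j = 0 then 0 else -Complex.I * momentCoeff b μ (m - Finsupp.single j 1) x) •
        Complex.ofRealCLM.comp (momentDiff μ (b j) x))
      (extChartAt (𝓡 n) x x) := by
  have h := hasFDerivAt_expCoeff (-Complex.I)
    (u := fun j y => μ ((extChartAt (𝓡 n) x).symm y) (b j)) (p := extChartAt (𝓡 n) x x)
    (ξ := fun j => momentDiff μ (b j) x)
    (fun j => ((contDiffAt_comp_extChartAt_symm (hμ (b j) x)).differentiableAt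
        (by simp)).hasFDerivAt.congr_fderiv (fderiv_comp_extChartAt_symm (hμ (b j)) x)) m
  rw [(extChartAt (𝓡 n) x).left_inv (mem_extChartAt_source x)] at h
  exact h

/-- The left side is the coefficient of $u^m$ in $\sum_{j,k}u_ju_kP_{jk}\sum_{m'}c_{m'}u^{m'}$, a
symmetric weight paired with an antisymmetric one. -/
theorem sum_sum_ite_mul_antisymm (c : (ι →₀ ℕ) → ℂ) (P : ι → ι → ℂ) (hP : ∀ j k, P j k = -P k j)
    (m : ι →₀ ℕ) :
    (∑ j, if m j = 0 then 0 else ∑ k, (if (m - Finsupp.single j 1 : ι →₀ ℕ) k = 0 then 0 else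
      c (m - Finsupp.single j 1 - Finsupp.single k 1)) * P j k) = 0 := by
  classical
  let T : ι → ι → ℂ := fun j k => if m j = 0 then 0 else
    if (m - Finsupp.single j 1 : ι →₀ ℕ) k = 0 then 0 else
      c (m - Finsupp.single j 1 - Finsupp.single k 1)
  -- Removing $u_j$ then $u_k$ from $u^m$ is independent of the order, guards included; on the
  -- diagonal there is nothing to prove.
  have hT : ∀ j k, T j k = T k j := by
    intro j k
    by_cases hjk : j = k
    · rw [hjk]
    · simp only [T, Finsupp.tsub_apply, Finsupp.single_apply, if_neg hjk, if_neg (Ne.symm hjk),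
        tsub_zero, tsub_right_comm (a := m) (b := Finsupp.single j 1)]
      split_ifs <;> rfl
  have hS : (∑ j, if m j = 0 then 0 else ∑ k, (if (m - Finsupp.single j 1 : ι →₀ ℕ) k = 0 then 0
      else c (m - Finsupp.single j 1 - Finsupp.single k 1)) * P j k) = ∑ j, ∑ k, T j k * P j k := by
    refine Finset.sum_congr rfl fun j _ => ?_
    by_cases hj : m j = 0 <;> simp [T, hj]
  rw [hS]
  have h : ∑ j, ∑ k, T j k * P j k = -∑ j, ∑ k, T j k * P j k := by
    conv_lhs => rw [Finset.sum_comm]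
    simp only [← Finset.sum_neg_distrib]
    exact Finset.sum_congr rfl fun j _ => Finset.sum_congr rfl fun k _ => by
      rw [hT k j, hP k j, mul_neg]
  exact self_eq_neg.1 h

theorem sum_mulVar_apply {M : Type*} [TopologicalSpace M] [ChartedSpace (Vec n) M]
    (θ : ι → EquivariantForm n M ι) (m : ι →₀ ℕ) (x : M) :
    formAt (∑ j, mulVar j (θ j) m) x =
      ∑ j, if m j = 0 then 0 else formAt (θ j (m - Finsupp.single j 1)) x := by
  change (∑ j, mulVar j (θ j) m) x = _
  rw [Finset.sum_apply]
  refine Finset.sum_congr rfl fun j _ => ?_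
  unfold mulVar
  split_ifs <;> rfl

end Equivariant

/-! ### The three conclusions for $\delta=\mathcal J d\mu$. -/

section Hamiltonian

variable {n : ℕ}
    {M : Type*} [TopologicalSpace M] [ChartedSpace (Vec n) M] [IsManifold (𝓡 n) ∞ M]
    [T2Space M] [SigmaCompactSpace M]
    {F : Type*} [NormedAddCommGroup F] [NormedSpace ℝ F]
    {E : M → Type*} [TopologicalSpace (TotalSpace F E)] [∀ x, TopologicalSpace (E x)]
    [∀ x, AddCommGroup (E x)] [∀ x, Module ℝ (E x)] [∀ x, IsTopologicalAddGroup (E x)]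
    [∀ x, ContinuousSMul ℝ (E x)] [FiberBundle F E] [VectorBundle ℝ F E]
    {C : ExtendedTangentBundle n M F E} {J : ExtendedComplexStructure C}
    {s : IsotropicSplitting C} {ρ : MixedDForm n M}
    {𝔤 : Type*} [AddCommGroup 𝔤] [Module ℝ 𝔤] {μ : M → Module.Dual ℝ 𝔤}
    {δ : 𝔤 →ₗ[ℝ] Cₛ^∞⟮𝓡 n; F, E⟯}
    {ι : Type*} [Fintype ι]

omit [T2Space M] [SigmaCompactSpace M] in
theorem pairing_eq_zero_of_eq_J_coanchor
    (hδ : ∀ τ x, δ τ x = J.J x (C.coanchor x (momentDiff μ τ x)))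
    (σ τ : 𝔤) (x : M) : C.pairing x (δ σ x) (δ τ x) = 0 := by
  rw [hδ, hδ, J.orthogonal]
  exact C.pairing_coanchor_coanchor x _ _

omit [IsManifold (𝓡 n) ∞ M] [T2Space M] [SigmaCompactSpace M] in
theorem expMoment_zero (b : Module.Basis ι ℝ 𝔤) (μ : M → Module.Dual ℝ 𝔤) (ρ : MixedDForm n M) :
    expMoment b μ ρ 0 = ρ := by
  funext x
  simp [expMoment]

theorem equivariantD_expMoment (hρ : IsExtendedCalabiYau s J ρ)
    (hμ : ∀ τ, ContMDiff (𝓡 n) 𝓘(ℝ, ℝ) ∞ (fun x => μ x τ))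
    (hδ : ∀ τ x, δ τ x = J.J x (C.coanchor x (momentDiff μ τ x)))
    (b : Module.Basis ι ℝ 𝔤) : equivariantD s δ b (expMoment b μ ρ) = 0 := by
  funext m x
  have h := s.dT_smul hρ.smooth _ x (hasFDerivAt_momentCoeff b hμ m x)
  change formAt (s.dT (expMoment b μ ρ m)) x -
    formAt (∑ j, mulVar j (fun m' => s.iota (δ (b j)) (expMoment b μ ρ m')) m) x = 0
  rw [sum_mulVar_apply, sub_eq_zero]
  refine h.trans ?_
  have h0 : formAt (s.dT ρ) x = 0 := congrFun hρ.closed x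
  rw [h0, smul_zero, add_zero]
  refine Finset.sum_congr rfl fun j _ => ?_
  split_ifs with hj
  · rw [zero_smul]
  -- The factor $-i$ from differentiating $e^{-i\mu}$ is the one relating $d\mu_j\wedge\rho$ to
  -- $\iota_{\delta(\tau_j)}\rho$.
  · have hJ := s.cliffordHom_J_coanchor J x (momentDiff μ (b j) x) (hρ.annihilated x)
    rw [← hδ] at hJ
    have hc := map_smul (s.cliffordHom x (δ (b j) x))
      (momentCoeff b μ (m - Finsupp.single j 1) x) (formAt ρ x)
    refine Eq.trans ?_ hc.symm
    rw [mul_comm, mul_smul]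
    exact congrArg _ hJ.symm

theorem expMoment_mem_cartanComplex [ContMDiffVectorBundle ∞ F E (𝓡 n)]
    (hρ : IsExtendedCalabiYau s J ρ)
    (hμ : ∀ τ, ContMDiff (𝓡 n) 𝓘(ℝ, ℝ) ∞ (fun x => μ x τ))
    (hδ : ∀ τ x, δ τ x = J.J x (C.coanchor x (momentDiff μ τ x)))
    (b : Module.Basis ι ℝ 𝔤) : expMoment b μ ρ ∈ cartanComplex s δ b := by
  refine ⟨fun m => hρ.smooth.smul (contMDiff_momentCoeff b hμ m), fun m => ?_⟩
  funext x
  change formAt (∑ j, mulVar j (fun m' => s.lieT (δ (b j)) (expMoment b μ ρ m')) m) x = 0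
  rw [sum_mulVar_apply]
  -- The spinor itself is invariant, so on each coefficient of $\rho_G$ only the scalar factor gets
  -- differentiated.
  have hL : ∀ τ, s.lieT (δ τ) ρ = 0 := fun τ =>
    s.lieT_eq_zero (δ τ) hρ.smooth hρ.closed (hμ τ) (-Complex.I) fun z => by
      rw [hδ]
      exact s.cliffordHom_J_coanchor J z _ (hρ.annihilated z)
  -- $P_{jk}=d\mu_k(\pi^\sharp d\mu_j)$ is, up to sign convention, the Poisson bracket of the
  -- components of $\mu$.
  let P : ι → ι → ℂ := fun j k => (momentDiff μ (b k) x (C.anchor x (δ (b j) x)) : ℂ)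
  have hP : ∀ j k, P j k = -P k j := fun j k => by
    simp only [P, hδ]
    exact_mod_cast congrArg Complex.ofReal (J.poisson_antisymm x _ _)
  have hterm : ∀ j, formAt (s.lieT (δ (b j)) (expMoment b μ ρ (m - Finsupp.single j 1))) x =
      (∑ k, (if (m - Finsupp.single j 1 : ι →₀ ℕ) k = 0 then 0 else -Complex.I *
        momentCoeff b μ (m - Finsupp.single j 1 - Finsupp.single k 1) x) * P j k) • formAt ρ x :=
    fun j => by
      refine (s.lieT_smul (δ (b j)) hρ.smooth _ x
        (hasFDerivAt_momentCoeff b hμ (m - Finsupp.single j 1) x)).trans ?_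
      have h0 : formAt (s.lieT (δ (b j)) ρ) x = 0 := congrFun (hL (b j)) x
      rw [h0, smul_zero, add_zero]
  have key := sum_sum_ite_mul_antisymm (fun m => -Complex.I * momentCoeff b μ m x) P hP m
  have h : (∑ j, if m j = 0 then 0 else
      formAt (s.lieT (δ (b j)) (expMoment b μ ρ (m - Finsupp.single j 1))) x) =
      (∑ j, if m j = 0 then (0 : ℂ) else ∑ k, (if (m - Finsupp.single j 1 : ι →₀ ℕ) k = 0 then 0
        else -Complex.I * momentCoeff b μ (m - Finsupp.single j 1 - Finsupp.single k 1) x) *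
          P j k) • formAt ρ x := by
    rw [Finset.sum_smul]
    refine Finset.sum_congr rfl fun j _ => ?_
    split_ifs with hj
    · rw [zero_smul]
    · exact hterm j
  rw [h, key, zero_smul]

end Hamiltonian

end ExtendedManifold

theorem mainTheorem12 {n d : ℕ}
    {M : Type*} [TopologicalSpace M] [ChartedSpace (Vec n) M] [IsManifold (𝓡 n) ∞ M]
    [T2Space M] [SigmaCompactSpace M]
    {F : Type*} [NormedAddCommGroup F] [NormedSpace ℝ F] [FiniteDimensional ℝ F]
    {E : M → Type*} [TopologicalSpace (TotalSpace F E)] [∀ x, TopologicalSpace (E x)]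
    [∀ x, AddCommGroup (E x)] [∀ x, Module ℝ (E x)] [∀ x, IsTopologicalAddGroup (E x)]
    [∀ x, ContinuousSMul ℝ (E x)] [FiberBundle F E] [VectorBundle ℝ F E]
    [ContMDiffVectorBundle ∞ F E (𝓡 n)]
    (C : ExtendedTangentBundle n M F E) (J : ExtendedComplexStructure C)
    (s : IsotropicSplitting C) (ρ : MixedDForm n M) (hρ : IsExtendedCalabiYau s J ρ)
    {G : Type*} [TopologicalSpace G] [ChartedSpace (Vec d) G] [Group G] [LieGroup (𝓡 d) ∞ G]
    [T2Space G] [ConnectedSpace G] [MulAction G M] [ContMDiffSMul (𝓡 d) (𝓡 n) ∞ G M]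
    (A : ExtendedAction (d := d) G C) (μ : M → Module.Dual ℝ (GroupLieAlgebra (𝓡 d) G))
    (hμ : IsHamiltonian J A μ)
    {ι : Type*} [Fintype ι] (b : Module.Basis ι ℝ (GroupLieAlgebra (𝓡 d) G)) :
    (∀ σ τ x, C.pairing x (A.δ σ x) (A.δ τ x) = 0) ∧
      expMoment b μ ρ 0 = ρ ∧
      expMoment b μ ρ ∈ cartanComplex s A.δ b ∧
      equivariantD s A.δ b (expMoment b μ ρ) = 0 :=
  ⟨pairing_eq_zero_of_eq_J_coanchor hμ.extended, expMoment_zero b μ ρ,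
    expMoment_mem_cartanComplex hρ hμ.smooth hμ.extended b,
    equivariantD_expMoment hρ hμ.smooth hμ.extended b⟩
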